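/- **Setting.** Let $T>0$, $N\ge 2$, and let $(\Omega,\mathcal F,(\mathcal F_t)_{0\le t\le T},\mathbb P)$ be a filtered probability space satisfying the usual conditions; write $\mathbb E_t=\mathbb E[\,\cdot\mid\mathcal F_t]$. Let $\mathcal U$ be the set of progressively measurable real processes $u$ with $\int_0^T\mathbb E[u_s^2]\,ds<\infty$. A kernel $K\in L^2([0,T]^2,\mathbb R)$ induces the operator $(\boldsymbol K f)(s)=\int_0^T K(s,r)f(r)\,dr$ on $L^2=L^2([0,T],\mathbb R)$, and $\boldsymbol K^*$ is induced by the adjoint kernel $K^*(s,r)=K(r,s)$. Let $\mathcal G$ be the class of measurable kernels $K:[0,T]^2\to[0,\infty)$ with $K(t,s)=0$ for $s\ge t$, with $\int_0^T\!\int_0^T (K(t,s)+K(s,t))f(s)f(t)\,ds\,dt\ge 0$ for all $f\in L^2$, and with $\sup_{t\le T}\int_0^T K(t,s)^2ds+\sup_{s\le T}\int_0^T K(t,s)^2dt<\infty$. Let $\lambda>0$, let $A_1,\hat A_2,A_3\in\mathcal G$ with induced operators $\boldsymbol A_1,\hat{\boldsymbol A}_2,\boldsymbol A_3$, and put $\boldsymbol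 A_2=\lambda\,\mathrm{id}+\hat{\boldsymbol A}_2$. Let $b^0,b^1,\dots,b^N\in\mathcal U$ and let $c^1,\dots,c^N$ be integrable random variables. For $u=(u^1,\dots,u^N)\in\mathcal U^N$ and $\bar u=\frac1N\sum_{j=1}^N u^j$, player $i$ maximises over $u^i\in\mathcal U$ $$J^i(u^i;u^{-i})=\mathbb E\big[-\langle\bar u,\boldsymbol A_1\bar u\rangle_{L^2}-\langle u^i,\boldsymbol A_2u^i\rangle_{L^2}-\langle u^i,(\boldsymbol A_3+\boldsymbol A_3^*)\bar u\rangle_{L^2}+\langle b^i,u^i\rangle_{L^2}+\langle b^0,\bar u\rangle_{L^2}+c^i\big].$$ A profile $\hat u\in\mathcal U^N$ is a Nash equilibrium if $J^i(\hat u^i;\hat u^{-i})\ge J^i(v;\hat u^{-i})$ for all $i$ and all $v\in\mathcal U$. Put $\bar b=\frac1N\sum_{i=1}^N b^i$ and $$G=\tfrac1{N^2}A_1+\tfrac2N A_3+\hat A_2,\qquad H=\tfrac1N A_1+A_3,\qquad \overline K=\tfrac{N-1}{N}H+G,$$ for a kernel $K$ let $\boldsymbol K_t$ be the operator with kernel $K_t(s,r)=K(s,r)1_{\{r\ge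 t\}}$, and define $$\overline{\boldsymbol D}_t=2\lambda\,\mathrm{id}+\tfrac{N-1}{N}(\boldsymbol H_t+\boldsymbol H_t^*)+\boldsymbol G_t+\boldsymbol G_t^*,$$ $$\overline a_t=\frac1{2\lambda}\Big(\bar b_t+\tfrac1N b^0_t-\big\langle 1_{\{t\le\cdot\}}\overline K(\cdot,t),\ \overline{\boldsymbol D}_t^{-1}1_{\{t\le\cdot\}}\mathbb E_t[\bar b_\cdot+\tfrac1N b^0_\cdot]\big\rangle_{L^2}\Big),$$ $$\overline B(t,s)=1_{\{s<t\}}\frac1{2\lambda}\Big(\big\langle 1_{\{t\le\cdot\}}\overline K(\cdot,t),\ \overline{\boldsymbol D}_t^{-1}1_{\{t\le\cdot\}}\overline K(\cdot,s)\big\rangle_{L^2}-\overline K(t,s)\Big).$$ **Theorem.** Let $\hat u^N=(\hat u^{1,N},\dots,\hat u^{N,N})\in\mathcal U^N$ be a Nash equilibrium and $\bar u^N=\frac1N\sum_{j=1}^N\hat u^{j,N}$. Then the objects below are well defined (each $\overline{\boldsymbol D}_t$, $t\in[0,T]$, is invertible on $L^2$; $\overline B\in L^2([0,T]^2)$; $\mathrm{id}-\overline{\boldsymbol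 B}$ is invertible on $L^2$; the random variables $\overline a_t$, each determined up to a null set, have a version $\overline a\in\mathcal U$), and for every progressively measurable version of $\overline a$, $$\bar u^N_t=\big((\mathrm{id}-\overline{\boldsymbol B})^{-1}\overline a\big)(t)\qquad d\mathbb P\otimes dt\text{-a.e. on }\Omega\times[0,T].$$ -/

import Mathlib

open MeasureTheory Filter
open scoped ENNReal

noncomputable section

namespace StochGame

/-! ## The space `L²([0,T])` and integral operators -/

/-- The time interval `[0,T]`. -/
abbrev Time (T : ℝ) : Type := Set.Icc (0 : ℝ) T

/-- Lebesgue measure on `[0,T]`. -/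
def leb (T : ℝ) : Measure (Time T) := Measure.comap Subtype.val volume

instance leb_isFiniteMeasure (T : ℝ) : IsFiniteMeasure (leb T) := by
  refine ⟨?_⟩
  unfold leb
  rw [Measure.comap_apply _ Subtype.coe_injective
    (fun s hs => measurableSet_Icc.subtype_image hs) _ MeasurableSet.univ]
  refine lt_of_le_of_lt (measure_mono (t := Set.Icc (0 : ℝ) T) ?_) ?_
  · rintro _ ⟨x, -, rfl⟩
    exact x.2
  · simp

/-- The Hilbert space `L²([0,T], ℝ)`. -/
abbrev L2 (T : ℝ) : Type := Lp ℝ 2 (leb T)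

open Classical in
/-- The class in `L²([0,T])` of a square-integrable function (and `0` for any other function). -/
def toL2 {T : ℝ} (f : Time T → ℝ) : L2 T :=
  if h : MemLp f 2 (leb T) then h.toLp f else 0

/-- A kernel `[0,T]² → ℝ`. -/
abbrev Kernel2 (T : ℝ) : Type := Time T → Time T → ℝ

/-- `K ∈ L²([0,T]²)`. -/
def SqIntegrableKernel {T : ℝ} (K : Kernel2 T) : Prop :=
  MemLp (Function.uncurry K) 2 ((leb T).prod (leb T))

/-- The adjoint kernel `K*(s,u) = K(u,s)`. -/
def adjKernel {T : ℝ} (K : Kernel2 T) : Kernel2 T := fun s u => K u s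

/-- The function `s ↦ ∫₀ᵀ K(s,u) f(u) du`. -/
def kernelApply {T : ℝ} (K : Kernel2 T) (f : Time T → ℝ) : Time T → ℝ :=
  fun s => ∫ u, K s u * f u ∂(leb T)

theorem slices_memLp {T : ℝ} {K : Kernel2 T} (hK : SqIntegrableKernel K) :
    ∀ᵐ s ∂(leb T), MemLp (K s) 2 (leb T) := by
  have hK' : MemLp (Function.uncurry K) 2 ((leb T).prod (leb T)) := hK
  have h1 := hK'.integrable_sq
  have h2 : ∀ᵐ s ∂(leb T), AEStronglyMeasurable (K s) (leb T) := hK'.1.prodMk_left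
  filter_upwards [h1.prod_right_ae, h2] with s hs hms
  exact (memLp_two_iff_integrable_sq hms).2 hs

theorem kernelApply_bound {T : ℝ} {K : Kernel2 T} (hK : SqIntegrableKernel K) (f : L2 T) :
    MemLp (kernelApply K f) 2 (leb T) ∧
      ∫ s, kernelApply K f s ^ 2 ∂(leb T) ≤
        (∫ p, (Function.uncurry K p) ^ 2 ∂((leb T).prod (leb T))) * ‖f‖ ^ 2 := by
  have hK' : MemLp (Function.uncurry K) 2 ((leb T).prod (leb T)) := hK
  have hint := hK'.integrable_sq
  have hmeas : AEStronglyMeasurable (kernelApply K f) (leb T) := by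
    have : AEStronglyMeasurable (fun p : Time T × Time T => Function.uncurry K p * f p.2)
        ((leb T).prod (leb T)) := hK'.1.mul (Lp.aestronglyMeasurable f).comp_snd
    exact this.integral_prod_right'
  have hbd : ∀ᵐ s ∂(leb T), kernelApply K f s ^ 2 ≤ (∫ u, K s u ^ 2 ∂(leb T)) * ‖f‖ ^ 2 := by
    filter_upwards [slices_memLp hK] with s hs
    have e1 : kernelApply K f s = inner ℝ (hs.toLp (K s)) f := by
      rw [L2.inner_def, kernelApply]
      refine integral_congr_ae ?_
      filter_upwards [hs.coeFn_toLp] with u hu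
      simp [hu, mul_comm]
    have e2 : ∫ u, K s u ^ 2 ∂(leb T) = ‖hs.toLp (K s)‖ ^ 2 := by
      rw [← real_inner_self_eq_norm_sq, L2.inner_def]
      refine integral_congr_ae ?_
      filter_upwards [hs.coeFn_toLp] with u hu
      simp [hu, sq]
    rw [e1, e2, ← mul_pow]
    exact sq_le_sq' (neg_le_of_abs_le (abs_real_inner_le_norm _ _)) (real_inner_le_norm _ _)
  have hdom : Integrable (fun s => (∫ u, K s u ^ 2 ∂(leb T)) * ‖f‖ ^ 2) (leb T) :=
    hint.integral_prod_left.mul_const _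
  have hsq : Integrable (fun s => kernelApply K f s ^ 2) (leb T) := by
    refine hdom.mono' (hmeas.pow 2) ?_
    filter_upwards [hbd] with s hs
    rwa [Real.norm_of_nonneg (sq_nonneg _)]
  refine ⟨(memLp_two_iff_integrable_sq hmeas).2 hsq, ?_⟩
  refine (integral_mono_ae hsq hdom hbd).trans (le_of_eq ?_)
  rw [integral_mul_const, integral_prod _ hint]
  rfl

theorem kernelApply_add {T : ℝ} {K : Kernel2 T} (hK : SqIntegrableKernel K) (f g : L2 T) :
    kernelApply K (f + g : L2 T) =ᵐ[leb T] kernelApply K f + kernelApply K g := by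
  filter_upwards [slices_memLp hK] with s hs
  have hf : Integrable (fun u => K s u * f u) (leb T) := hs.integrable_mul (Lp.memLp f)
  have hg : Integrable (fun u => K s u * g u) (leb T) := hs.integrable_mul (Lp.memLp g)
  simp only [kernelApply, Pi.add_apply]
  rw [← integral_add hf hg]
  refine integral_congr_ae ?_
  filter_upwards [Lp.coeFn_add f g] with u hu
  rw [hu, Pi.add_apply, mul_add]

theorem kernelApply_smul {T : ℝ} (K : Kernel2 T) (c : ℝ) (f : L2 T) :
    kernelApply K (c • f : L2 T) = c • kernelApply K f := by
  funext s
  simp only [kernelApply, Pi.smul_apply, smul_eq_mul]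
  rw [← integral_const_mul]
  refine integral_congr_ae ?_
  filter_upwards [Lp.coeFn_smul c f] with u hu
  rw [hu, Pi.smul_apply, smul_eq_mul]
  ring

/-- The bounded operator on `L²([0,T])` induced by a kernel in `L²([0,T]²)`. -/
def mkIntegralOp {T : ℝ} (K : Kernel2 T) (hK : SqIntegrableKernel K) : L2 T →L[ℝ] L2 T :=
  LinearMap.mkContinuous
    { toFun := fun f => (kernelApply_bound hK f).1.toLp (kernelApply K f)
      map_add' := fun f g => by
        rw [← MemLp.toLp_add]
        exact (MemLp.toLp_eq_toLp_iff _ _).2 (kernelApply_add hK f g)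
      map_smul' := fun c f => by
        rw [RingHom.id_apply, ← MemLp.toLp_const_smul]
        exact (MemLp.toLp_eq_toLp_iff _ _).2 (by rw [kernelApply_smul]) }
    (Real.sqrt (∫ p, (Function.uncurry K p) ^ 2 ∂((leb T).prod (leb T))))
    (fun f => by
      have h := kernelApply_bound hK f
      have e : ‖h.1.toLp (kernelApply K f)‖ ^ 2 = ∫ s, kernelApply K f s ^ 2 ∂(leb T) := by
        rw [← real_inner_self_eq_norm_sq, L2.inner_def]
        refine integral_congr_ae ?_
        filter_upwards [h.1.coeFn_toLp] with u hu
        simp [hu, sq]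
      refine le_of_sq_le_sq ?_ (by positivity)
      simp only [LinearMap.coe_mk, AddHom.coe_mk]
      rw [e, mul_pow, Real.sq_sqrt (integral_nonneg fun p => sq_nonneg _)]
      exact h.2)

open Classical in
/-- The integral operator `(𝑲 f)(s) = ∫₀ᵀ K(s,u) f(u) du` on `L²([0,T])` induced by a kernel
`K ∈ L²([0,T]²)` (and `0` for any other kernel). -/
def intOp {T : ℝ} (K : Kernel2 T) : L2 T →L[ℝ] L2 T :=
  if hK : SqIntegrableKernel K then mkIntegralOp K hK else 0

theorem intOp_apply {T : ℝ} {K : Kernel2 T} (hK : SqIntegrableKernel K) (f : L2 T) :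
    intOp K f =ᵐ[leb T] fun s => ∫ u, K s u * f u ∂(leb T) := by
  rw [intOp, dif_pos hK]
  exact (kernelApply_bound hK f).1.coeFn_toLp

/-- The class `𝒢` of admissible kernels: nonnegative definite Volterra kernels with values in
`[0,∞)` whose sections are bounded in `L²`. -/
structure AdmissibleKernel {T : ℝ} (G : Kernel2 T) : Prop where
  measurable : Measurable (Function.uncurry G)
  nonneg : ∀ t s, 0 ≤ G t s
  volterra : ∀ t s, t ≤ s → G t s = 0
  nonneg_definite : ∀ f : Time T → ℝ, MemLp f 2 (leb T) →
    0 ≤ ∫ t, ∫ s, (G t s + G s t) * f s * f t ∂(leb T) ∂(leb T)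
  sup_lt_top : (⨆ t, ∫⁻ s, ENNReal.ofReal (|G t s| ^ 2) ∂(leb T)) +
    (⨆ s, ∫⁻ t, ENNReal.ofReal (|G t s| ^ 2) ∂(leb T)) < ∞

/-- The truncated kernel `G_t(s,r) = G(s,r) 1_{r ≥ t}`. -/
def truncKernel {T : ℝ} (G : Kernel2 T) (t : Time T) : Kernel2 T :=
  fun s r => if t ≤ r then G s r else 0

/-! ## The game -/

/-- The usual conditions: right-continuity, and all null sets lie in every `ℱ_t` (in particular
the probability space is complete). -/
structure UsualConditions {T : ℝ} {Ω : Type*} [mΩ : MeasurableSpace Ω] (P : Measure Ω)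
    (ℱ : Filtration (Time T) mΩ) : Prop where
  right_cont : ℱ.IsRightContinuous
  complete : ∀ t (A : Set Ω), P A = 0 → MeasurableSet[ℱ t] A

/-- The set `𝒰`: progressively measurable processes `u` with `∫₀ᵀ 𝔼[u_s²] ds < ∞`. -/
structure AdmissibleProcess {T : ℝ} {Ω : Type*} [mΩ : MeasurableSpace Ω] (P : Measure Ω)
    (ℱ : Filtration (Time T) mΩ) (u : Time T → Ω → ℝ) : Prop where
  prog : IsStronglyProgressive ℱ u
  sq_int : ∫⁻ s, ∫⁻ ω, ENNReal.ofReal (u s ω ^ 2) ∂P ∂(leb T) < ∞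

/-- The path `u_·(ω)` as an element of `L²([0,T])`. -/
def path {T : ℝ} {Ω : Type*} (u : Time T → Ω → ℝ) (ω : Ω) : L2 T := toL2 fun t => u t ω

/-- The average `(1/N) ∑_j u^j` of a family of processes. -/
def avg {T : ℝ} {Ω : Type*} {N : ℕ} (u : Fin N → Time T → Ω → ℝ) : Time T → Ω → ℝ :=
  fun t ω => (1 / (N : ℝ)) * ∑ j, u j t ω

/-- The operator `A₂ = λ id + Â₂`. -/
def opA2 {T : ℝ} (lam : ℝ) (A2hat : Kernel2 T) : L2 T →L[ℝ] L2 T :=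
  lam • ContinuousLinearMap.id ℝ (L2 T) + intOp A2hat

/-- The performance functional of player `i`, for the strategy profile `u`. Here `A1, A2hat, A3`
are the kernels of `A₁, Â₂, A₃`. -/
def performance {T : ℝ} {Ω : Type*} [MeasurableSpace Ω] (P : Measure Ω) {N : ℕ}
    (lam : ℝ) (A1 A2hat A3 : Kernel2 T) (b0 : Time T → Ω → ℝ) (b : Fin N → Time T → Ω → ℝ)
    (c : Fin N → Ω → ℝ) (i : Fin N) (u : Fin N → Time T → Ω → ℝ) : ℝ :=
  ∫ ω, (- inner ℝ (path (avg u) ω) (intOp A1 (path (avg u) ω))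
        - inner ℝ (path (u i) ω) (opA2 lam A2hat (path (u i) ω))
        - inner ℝ (path (u i) ω) ((intOp A3 + intOp (adjKernel A3)) (path (avg u) ω))
        + inner ℝ (path (b i) ω) (path (u i) ω)
        + inner ℝ (path b0 ω) (path (avg u) ω)
        + c i ω) ∂P

/-- Nash equilibria of the game in which player `i` maximises `performance … i` over `𝒰`. -/
structure IsNashEquilibrium {T : ℝ} {Ω : Type*} [mΩ : MeasurableSpace Ω] (P : Measure Ω)
    (ℱ : Filtration (Time T) mΩ) {N : ℕ} (lam : ℝ) (A1 A2hat A3 : Kernel2 T)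
    (b0 : Time T → Ω → ℝ) (b : Fin N → Time T → Ω → ℝ) (c : Fin N → Ω → ℝ)
    (u : Fin N → Time T → Ω → ℝ) : Prop where
  admissible : ∀ i, AdmissibleProcess P ℱ (u i)
  optimal : ∀ i, ∀ v : Time T → Ω → ℝ, AdmissibleProcess P ℱ v →
    performance P lam A1 A2hat A3 b0 b c i (Function.update u i v) ≤
      performance P lam A1 A2hat A3 b0 b c i u

/-! ## The coefficients of the closed-form solution -/

/-- The kernel `G = A₁/N² + 2 A₃/N + Â₂`. -/
def kerG {T : ℝ} (N : ℕ) (A1 A2hat A3 : Kernel2 T) : Kernel2 T :=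
  fun t s => A1 t s / (N : ℝ) ^ 2 + 2 * (A3 t s / (N : ℝ)) + A2hat t s

/-- The kernel `H = A₁/N + A₃`. -/
def kerH {T : ℝ} (N : ℕ) (A1 A3 : Kernel2 T) : Kernel2 T :=
  fun t s => A1 t s / (N : ℝ) + A3 t s

/-- The kernel `K̄ = ((N-1)/N) H + G`. -/
def kerKbar {T : ℝ} (N : ℕ) (A1 A2hat A3 : Kernel2 T) : Kernel2 T :=
  fun t s => ((N : ℝ) - 1) / (N : ℝ) * kerH N A1 A3 t s + kerG N A1 A2hat A3 t s

/-- The operator `D̄_t = 2λ id + ((N-1)/N) (H_t + H_t^*) + G_t + G_t^*`. -/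
def opDbar {T : ℝ} (N : ℕ) (lam : ℝ) (A1 A2hat A3 : Kernel2 T) (t : Time T) :
    L2 T →L[ℝ] L2 T :=
  (2 * lam) • ContinuousLinearMap.id ℝ (L2 T)
    + (((N : ℝ) - 1) / (N : ℝ)) • (intOp (truncKernel (kerH N A1 A3) t)
        + intOp (adjKernel (truncKernel (kerH N A1 A3) t)))
    + intOp (truncKernel (kerG N A1 A2hat A3) t)
    + intOp (adjKernel (truncKernel (kerG N A1 A2hat A3) t))

/-- The element `1_{t ≤ ·} f` of `L²([0,T])`. -/
def restrictFrom {T : ℝ} (t : Time T) (f : Time T → ℝ) : L2 T :=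
  toL2 fun s => if t ≤ s then f s else 0

/-- The kernel
`B̄(t,s) = 1_{s<t} (2λ)⁻¹ (⟨1_{t≤·} K̄(·,t), D̄_t⁻¹ 1_{t≤·} K̄(·,s)⟩ - K̄(t,s))`. -/
def kerBbar {T : ℝ} (N : ℕ) (lam : ℝ) (A1 A2hat A3 : Kernel2 T) : Kernel2 T :=
  fun t s =>
    if s < t then
      1 / (2 * lam) *
        (inner ℝ (restrictFrom t fun r => kerKbar N A1 A2hat A3 r t)
            (Ring.inverse (opDbar N lam A1 A2hat A3 t)
              (restrictFrom t fun r => kerKbar N A1 A2hat A3 r s))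
          - kerKbar N A1 A2hat A3 t s)
    else 0

/-- The process `b̄ + b⁰/N`. -/
def drift {T : ℝ} {Ω : Type*} {N : ℕ} (b0 : Time T → Ω → ℝ) (b : Fin N → Time T → Ω → ℝ) :
    Time T → Ω → ℝ :=
  fun t ω => avg b t ω + 1 / (N : ℝ) * b0 t ω

/-- The random element `𝔼_t[f_·]` of `L²([0,T])`: the conditional expectation given `ℱ_t` of the
`L²([0,T])`-valued random variable `ω ↦ f_·(ω)`. -/
def condPath {T : ℝ} {Ω : Type*} [mΩ : MeasurableSpace Ω] (P : Measure Ω)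
    (ℱ : Filtration (Time T) mΩ) (f : Time T → Ω → ℝ) (t : Time T) : Ω → L2 T :=
  P[path f | ℱ t]

/-- The random variable
`ā_t = (2λ)⁻¹ (b̄_t + b⁰_t/N - ⟨1_{t≤·} K̄(·,t), D̄_t⁻¹ 1_{t≤·} 𝔼_t[b̄_· + b⁰_·/N]⟩)`,
which is determined up to a null set for each `t`. -/
def abarAt {T : ℝ} {Ω : Type*} [mΩ : MeasurableSpace Ω] (P : Measure Ω)
    (ℱ : Filtration (Time T) mΩ) {N : ℕ} (lam : ℝ) (A1 A2hat A3 : Kernel2 T)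
    (b0 : Time T → Ω → ℝ) (b : Fin N → Time T → Ω → ℝ) (t : Time T) (ω : Ω) : ℝ :=
  1 / (2 * lam) *
    (avg b t ω + 1 / (N : ℝ) * b0 t ω
      - inner ℝ (restrictFrom t fun r => kerKbar N A1 A2hat A3 r t)
          (Ring.inverse (opDbar N lam A1 A2hat A3 t)
            (restrictFrom t (condPath P ℱ (drift b0 b) t ω))))

/-- The operator `id - B̄`. -/
def idSubBbar {T : ℝ} (N : ℕ) (lam : ℝ) (A1 A2hat A3 : Kernel2 T) : L2 T →L[ℝ] L2 T :=
  ContinuousLinearMap.id ℝ (L2 T) - intOp (kerBbar N lam A1 A2hat A3)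

end StochGame

end

noncomputable section

namespace StochGame

variable {T : ℝ}

/-! Each player's functional is exactly quadratic along a perturbation of the own strategy, so at an
equilibrium its first variation vanishes in every admissible direction
(`IsNashEquilibrium.integral_rewardDeriv_eq_zero`). The first variation is affine in the player's
own data, hence averaging over the players gives a condition on the mean strategy `u` alone: with
`K` for `kerKbar` and `d` for `drift`, the residual `2λu + Ku + K*u - d` is orthogonal to all
admissible strategies (`IsNashEquilibrium.integral_inner_residual`).

The term `K*u` looks into the future. To remove it, write `P_t` for restriction to `[t,T]`.
Conditioning the equation on `ℱ_t` and restricting to `[t,T]` gives an equation for the predicted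
future `P_t 𝔼_t[u]`, driven by `𝔼_t[d]` and by the known past `u - P_t u`. Its operator is `D_t = 2λ
+ K P_t + P_t K*`, which is `opDbar` and is bounded below by `2λ`, because the Volterra property
turns both nonlocal terms into `⟨P_t f, K P_t f⟩ ≥ 0`. Solving it (`condExp_future_eq`) and pairing
with `K(·,t)` expresses `𝔼_t⟨K(·,t), u⟩` through the past and `𝔼_t[d]` (`condExp_inner_col_eq`).
Substitution yields `u = a + B u` with a square-integrable Volterra kernel `B`, and `id - B` is
invertible because an exponential weight makes `B` a contraction (`isUnit_id_sub_intOp`).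

Two points need care. The family `𝔼_t[d]`, defined only up to a null set for each `t`, needs a
progressively measurable version (`exists_prog_condExp`). And the averaged condition is known only
in weak form; `feedback_form` tests it with the defect `z = u - a - Bu` itself, for which the
pairing with the residual equals `2λ 𝔼∫z²`. -/

instance secondCountable_L2 : SecondCountableTopology (L2 T) :=
  haveI : Fact ((2 : ℝ≥0∞) ≠ ∞) := ⟨by simp⟩
  Lp.SecondCountableTopology

/-! ### Classes of functions in `L²([0,T])` and measurability of `L²`-valued maps. -/

theorem toL2_of_memLp {f : Time T → ℝ} (h : MemLp f 2 (leb T)) : toL2 f = h.toLp f :=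
  dif_pos h

theorem coeFn_toL2 {f : Time T → ℝ} (h : MemLp f 2 (leb T)) : toL2 f =ᵐ[leb T] f := by
  rw [toL2_of_memLp h]
  exact h.coeFn_toLp

theorem toL2_coe (f : L2 T) : toL2 (f : Time T → ℝ) = f := by
  rw [toL2_of_memLp (Lp.memLp f), Lp.toLp_coeFn]

theorem toL2_congr {f g : Time T → ℝ} (h : f =ᵐ[leb T] g) : toL2 f = toL2 g := by
  by_cases hf : MemLp f 2 (leb T)
  · rw [toL2_of_memLp hf, toL2_of_memLp ((memLp_congr_ae h).1 hf)]
    exact (MemLp.toLp_eq_toLp_iff _ _).2 h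
  · rw [toL2, toL2, dif_neg hf, dif_neg (fun hg => hf ((memLp_congr_ae h).2 hg))]

theorem enorm_sq_eq_ofReal_sq (x : ℝ) : ‖x‖ₑ ^ 2 = ENNReal.ofReal (x ^ 2) := by
  rw [← ofReal_norm, ← ENNReal.ofReal_pow (norm_nonneg _), Real.norm_eq_abs, sq_abs]

theorem memLp_two_iff_lintegral_sq {X : Type*} [MeasurableSpace X] {μ : Measure X} {f : X → ℝ}
    (hf : AEStronglyMeasurable f μ) :
    MemLp f 2 μ ↔ ∫⁻ x, ENNReal.ofReal (f x ^ 2) ∂μ < ∞ := by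
  have h : eLpNorm f 2 μ ^ 2 = ∫⁻ x, ENNReal.ofReal (f x ^ 2) ∂μ := by
    simp_rw [← enorm_sq_eq_ofReal_sq]
    have := eLpNorm_nnreal_pow_eq_lintegral (f := f) (μ := μ) (p := 2) two_ne_zero
    simpa using this
  rw [← h]
  refine ⟨fun h => ENNReal.pow_lt_top h.2, fun h => ⟨hf, ?_⟩⟩
  by_contra hc
  rw [not_lt, top_le_iff] at hc
  simp [hc] at h

theorem enorm_L2_sq (f : L2 T) : ‖f‖ₑ ^ 2 = ∫⁻ s, ENNReal.ofReal (f s ^ 2) ∂(leb T) := by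
  simp_rw [← enorm_sq_eq_ofReal_sq]
  have := eLpNorm_nnreal_pow_eq_lintegral (f := f) (μ := leb T) (p := 2) two_ne_zero
  rw [Lp.enorm_def]
  simpa using this

theorem enorm_toL2_sq {f : Time T → ℝ} (h : MemLp f 2 (leb T)) :
    ‖toL2 f‖ₑ ^ 2 = ∫⁻ s, ENNReal.ofReal (f s ^ 2) ∂(leb T) := by
  rw [enorm_L2_sq]
  refine lintegral_congr_ae ?_
  filter_upwards [coeFn_toL2 h] with s hs
  rw [hs]

theorem toL2_sub {f g : Time T → ℝ} (hf : MemLp f 2 (leb T)) (hg : MemLp g 2 (leb T)) :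
    toL2 (fun t => f t - g t) = toL2 f - toL2 g := by
  rw [toL2_of_memLp hf, toL2_of_memLp hg, ← MemLp.toLp_sub, toL2_of_memLp (f := fun t => f t - g t) (hf.sub hg)]
  rfl

theorem toL2_add {f g : Time T → ℝ} (hf : MemLp f 2 (leb T)) (hg : MemLp g 2 (leb T)) :
    toL2 (fun t => f t + g t) = toL2 f + toL2 g := by
  rw [toL2_of_memLp hf, toL2_of_memLp hg, ← MemLp.toLp_add, toL2_of_memLp (f := fun t => f t + g t) (hf.add hg)]
  rfl

theorem toL2_const_mul {f : Time T → ℝ} (c : ℝ) (hf : MemLp f 2 (leb T)) :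
    toL2 (fun t => c * f t) = c • toL2 f := by
  rw [toL2_of_memLp hf, ← MemLp.toLp_const_smul,
    toL2_of_memLp (f := fun t => c * f t) (hf.const_mul c)]
  rfl

theorem inner_L2 (f g : L2 T) : inner ℝ f g = ∫ s, f s * g s ∂(leb T) := by
  rw [L2.inner_def]
  refine integral_congr_ae (ae_of_all _ fun s => ?_)
  simp [mul_comm]

theorem inner_toL2 {f g : Time T → ℝ} (hf : MemLp f 2 (leb T)) (hg : MemLp g 2 (leb T)) :
    inner ℝ (toL2 f) (toL2 g) = ∫ s, f s * g s ∂(leb T) := by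
  rw [inner_L2]
  refine integral_congr_ae ?_
  filter_upwards [coeFn_toL2 hf, coeFn_toL2 hg] with s h1 h2
  rw [h1, h2]

/-- A map into a second-countable metric space is strongly measurable as soon as its distances to
all points are measurable. -/
theorem stronglyMeasurable_of_edist {X E : Type*} [MeasurableSpace X] [PseudoEMetricSpace E]
    [SecondCountableTopology E] {f : X → E}
    (h : ∀ y, Measurable fun x => edist (f x) y) : StronglyMeasurable f := by
  borelize E
  refine Measurable.stronglyMeasurable ?_
  refine measurable_of_isOpen fun U hU => ?_
  obtain ⟨S, hS, hd⟩ := TopologicalSpace.exists_countable_dense E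
  have key : f ⁻¹' U = ⋃ y ∈ S, ⋃ n : ℕ, ⋃ (_ : Metric.eball y ((n : ℝ≥0∞)⁻¹) ⊆ U),
      {x | edist (f x) y < (n : ℝ≥0∞)⁻¹} := by
    ext x
    simp only [Set.mem_preimage, Set.mem_iUnion, Set.mem_ofPred_eq, exists_prop]
    constructor
    · intro hx
      obtain ⟨ε, hε, hsub⟩ := EMetric.isOpen_iff.1 hU _ hx
      obtain ⟨n, hn⟩ := ENNReal.exists_inv_nat_lt (ENNReal.half_pos hε.ne').ne'
      obtain ⟨y, hyS, hy⟩ := EMetric.mem_closure_iff.1 (hd (f x)) (n : ℝ≥0∞)⁻¹ (by simp)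
      refine ⟨y, hyS, n, fun z hz => hsub ?_, hy⟩
      rw [Metric.mem_eball] at hz ⊢
      calc edist z (f x) ≤ edist z y + edist y (f x) := edist_triangle _ _ _
        _ < ε / 2 + ε / 2 := by
            refine ENNReal.add_lt_add (hz.trans hn) ?_
            rw [edist_comm]
            exact hy.trans hn
        _ = ε := ENNReal.add_halves ε
    · rintro ⟨y, -, n, hsub, hlt⟩
      exact hsub hlt
  rw [key]
  refine MeasurableSet.biUnion hS fun y _ => MeasurableSet.iUnion fun n =>
    MeasurableSet.iUnion fun _ => measurableSet_lt (h y) measurable_const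

/-- By the distance criterion it suffices to fix `g`. The squared distance to `g` is a Tonelli
integral of a jointly measurable function; on the measurable set of `x` whose section is not square
integrable, `toL2` is `0` and the distance is `‖g‖ₑ`. The σ-algebra on `X` is arbitrary, so the
lemma also applies with `ℱ t`. -/
theorem stronglyMeasurable_toL2 {X : Type*} [MeasurableSpace X] {f : Time T → X → ℝ}
    (hf : Measurable (Function.uncurry f)) :
    StronglyMeasurable fun x => toL2 fun t => f t x := by
  have hf' : ∀ x, Measurable fun t => f t x := fun x => hf.comp (measurable_id.prodMk measurable_const)
  have hmem : ∀ x, MemLp (fun t => f t x) 2 (leb T) ↔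
      ∫⁻ s, ENNReal.ofReal (f s x ^ 2) ∂(leb T) < ∞ := fun x =>
    memLp_two_iff_lintegral_sq (hf' x).aestronglyMeasurable
  refine stronglyMeasurable_of_edist fun g => ?_
  have hg : Measurable (g : Time T → ℝ) := (Lp.stronglyMeasurable g).measurable
  have hset : MeasurableSet {x | ∫⁻ s, ENNReal.ofReal (f s x ^ 2) ∂(leb T) < ∞} := by
    refine measurableSet_lt (Measurable.lintegral_prod_left' (f := fun p : Time T × X =>
      ENNReal.ofReal (f p.1 p.2 ^ 2)) ?_) measurable_const
    exact (hf.pow_const 2).ennreal_ofReal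
  have hint : Measurable fun x => ∫⁻ s, ENNReal.ofReal ((f s x - g s) ^ 2) ∂(leb T) := by
    refine Measurable.lintegral_prod_left' (f := fun p : Time T × X =>
      ENNReal.ofReal ((f p.1 p.2 - g p.1) ^ 2)) ?_
    exact ((hf.sub (hg.comp measurable_fst)).pow_const 2).ennreal_ofReal
  have heq : (fun x => edist (toL2 fun t => f t x) g) = fun x =>
      open Classical in
      if x ∈ {x | ∫⁻ s, ENNReal.ofReal (f s x ^ 2) ∂(leb T) < ∞} then
        (∫⁻ s, ENNReal.ofReal ((f s x - g s) ^ 2) ∂(leb T)) ^ (2⁻¹ : ℝ) else ‖g‖ₑ := by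
    funext x
    split_ifs with hx
    · have hm := (hmem x).2 hx
      have h2 : toL2 (fun t => f t x) - g = toL2 fun t => f t x - g t := by
        rw [toL2_sub hm (Lp.memLp g), toL2_coe]
      rw [edist_eq_enorm_sub, h2, ← enorm_toL2_sq (f := fun t => f t x - g t)
        (hm.sub (Lp.memLp g)), ← ENNReal.rpow_natCast, ← ENNReal.rpow_mul]
      simp
    · rw [toL2, dif_neg (fun h => hx ((hmem x).1 h)), edist_eq_enorm_sub, zero_sub, enorm_neg]
  rw [heq]
  exact Measurable.ite hset (hint.pow_const _) measurable_const

/-! ### Paths of jointly measurable processes -/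

section Paths

variable {Ω : Type*} [mΩ : MeasurableSpace Ω] {P : Measure Ω}

theorem lintegral_enorm_path_sq {f : Time T → Ω → ℝ} [SFinite P]
    (hf : Measurable (Function.uncurry f))
    (h : ∀ᵐ ω ∂P, MemLp (fun t => f t ω) 2 (leb T)) :
    ∫⁻ ω, ‖path f ω‖ₑ ^ 2 ∂P = ∫⁻ s, ∫⁻ ω, ENNReal.ofReal (f s ω ^ 2) ∂P ∂(leb T) := by
  rw [lintegral_lintegral_swap]
  · refine lintegral_congr_ae ?_
    filter_upwards [h] with ω hω
    rw [path, enorm_toL2_sq hω]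
  · exact (hf.pow_const 2).ennreal_ofReal.aemeasurable

theorem ae_memLp_path {f : Time T → Ω → ℝ} [SFinite P] (hf : Measurable (Function.uncurry f))
    (h : ∫⁻ s, ∫⁻ ω, ENNReal.ofReal (f s ω ^ 2) ∂P ∂(leb T) < ∞) :
    ∀ᵐ ω ∂P, MemLp (fun t => f t ω) 2 (leb T) := by
  have hm : Measurable fun p : Time T × Ω => ENNReal.ofReal (f p.1 p.2 ^ 2) :=
    (hf.pow_const 2).ennreal_ofReal
  rw [lintegral_lintegral_swap hm.aemeasurable] at h
  filter_upwards [ae_lt_top (Measurable.lintegral_prod_left' hm) h.ne] with ω hω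
  exact (memLp_two_iff_lintegral_sq
    (hf.comp (measurable_id.prodMk measurable_const)).aestronglyMeasurable).2 hω

theorem memLp_two_iff_lintegral_enorm_sq {E : Type*} [NormedAddCommGroup E] {f : Ω → E}
    (hf : AEStronglyMeasurable f P) : MemLp f 2 P ↔ ∫⁻ ω, ‖f ω‖ₑ ^ 2 ∂P < ∞ := by
  have h : eLpNorm f 2 P ^ 2 = ∫⁻ ω, ‖f ω‖ₑ ^ 2 ∂P := by
    have := eLpNorm_nnreal_pow_eq_lintegral (f := f) (μ := P) (p := 2) two_ne_zero
    simpa using this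
  rw [← h]
  refine ⟨fun h => ENNReal.pow_lt_top h.2, fun h => ⟨hf, ?_⟩⟩
  by_contra hc
  rw [not_lt, top_le_iff] at hc
  simp [hc] at h

theorem memLp_path {f : Time T → Ω → ℝ} [SFinite P] (hf : Measurable (Function.uncurry f))
    (h : ∫⁻ s, ∫⁻ ω, ENNReal.ofReal (f s ω ^ 2) ∂P ∂(leb T) < ∞) : MemLp (path f) 2 P := by
  have hm : AEStronglyMeasurable (path f) P := (stronglyMeasurable_toL2 hf).aestronglyMeasurable
  rw [memLp_two_iff_lintegral_enorm_sq hm,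
    lintegral_enorm_path_sq hf (ae_memLp_path hf h)]
  exact h

/-- Transfers square integrability back from the Hilbert space to processes, so that closure
properties of admissible strategies follow from those of `MemLp` for `L2 T`-valued maps. -/
theorem lintegral_sq_lt_top {f : Time T → Ω → ℝ} [SFinite P]
    (hf : Measurable (Function.uncurry f)) {ψ : Ω → L2 T} (hψ : MemLp ψ 2 P)
    (h : ∀ᵐ ω ∂P, ψ ω =ᵐ[leb T] fun t => f t ω) :
    ∫⁻ s, ∫⁻ ω, ENNReal.ofReal (f s ω ^ 2) ∂P ∂(leb T) < ∞ := by
  have h' : ∀ᵐ ω ∂P, MemLp (fun t => f t ω) 2 (leb T) := by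
    filter_upwards [h] with ω hω
    exact (memLp_congr_ae hω).1 (Lp.memLp _)
  rw [← lintegral_enorm_path_sq hf h']
  refine lt_of_eq_of_lt (lintegral_congr_ae ?_)
    ((memLp_two_iff_lintegral_enorm_sq hψ.1).1 hψ)
  filter_upwards [h] with ω hω
  rw [path, ← toL2_congr hω, toL2_coe]

end Paths

/-! ### Progressive measurability -/

/-- Extension by zero trades the subtype `Set.Iic i` for the whole time interval, where Tonelli and
parametrised integrals over `leb T` apply directly. -/
theorem measurable_restrict_Iic_iff {X : Type*} [MeasurableSpace X] (i : Time T)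
    (f : Time T → X → ℝ) :
    (StronglyMeasurable fun p : Set.Iic i × X => f p.1 p.2) ↔
      Measurable fun p : Time T × X => if p.1 ≤ i then f p.1 p.2 else 0 := by
  have hs : MeasurableSet {p : Time T × X | p.1 ≤ i} := measurable_fst measurableSet_Iic
  constructor
  · intro h
    refine measurable_of_restrict_of_restrict_compl hs ?_ ?_
    · have e : Set.domRestrict {p : Time T × X | p.1 ≤ i}
          (fun p : Time T × X => if p.1 ≤ i then f p.1 p.2 else 0) =
          (fun p : Set.Iic i × X => f p.1 p.2) ∘
            fun q : {p : Time T × X | p.1 ≤ i} => (⟨q.1.1, q.2⟩, q.1.2) := by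
        funext q
        exact if_pos q.2
      rw [e]
      refine h.measurable.comp (Measurable.prodMk ?_ ?_)
      · exact (measurable_fst.comp measurable_subtype_coe).subtype_mk
      · exact measurable_snd.comp measurable_subtype_coe
    · have e : Set.domRestrict {p : Time T × X | p.1 ≤ i}ᶜ
          (fun p : Time T × X => if p.1 ≤ i then f p.1 p.2 else 0) = fun _ => 0 := by
        funext q
        exact if_neg q.2
      rw [e]
      exact measurable_const
  · intro h
    have e : (fun p : Set.Iic i × X => f p.1 p.2) =
        (fun p : Time T × X => if p.1 ≤ i then f p.1 p.2 else 0) ∘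
          fun q : Set.Iic i × X => ((q.1 : Time T), q.2) := by
      funext q
      exact (if_pos q.1.2).symm
    rw [e]
    refine (h.comp (Measurable.prodMk ?_ ?_)).stronglyMeasurable
    · exact measurable_subtype_coe.comp measurable_fst
    · exact measurable_snd

section Progressive

variable {Ω : Type*} [mΩ : MeasurableSpace Ω] {P : Measure Ω} {ℱ : Filtration (Time T) mΩ}

theorem isStronglyProgressive_iff {u : Time T → Ω → ℝ} :
    IsStronglyProgressive ℱ u ↔
      ∀ i, Measurable[@Prod.instMeasurableSpace _ _ _ (ℱ i)]
        fun p : Time T × Ω => if p.1 ≤ i then u p.1 p.2 else 0 :=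
  forall_congr' fun i => @measurable_restrict_Iic_iff T Ω (ℱ i) i u

/-- Progressivity at the terminal time, where the cut-off is vacuous. -/
theorem measurable_uncurry_of_prog (hT : 0 ≤ T) {u : Time T → Ω → ℝ}
    (hu : IsStronglyProgressive ℱ u) : Measurable (Function.uncurry u) := by
  have h := isStronglyProgressive_iff.1 hu ⟨T, hT, le_rfl⟩
  have e : (fun p : Time T × Ω => if p.1 ≤ (⟨T, hT, le_rfl⟩ : Time T) then u p.1 p.2 else 0) =
      Function.uncurry u := by
    funext p
    exact if_pos p.1.2.2
  rw [e] at h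
  exact h.mono (sup_le_sup le_rfl (MeasurableSpace.comap_mono (ℱ.le _))) le_rfl

theorem prog_add {u v : Time T → Ω → ℝ} (hu : IsStronglyProgressive ℱ u)
    (hv : IsStronglyProgressive ℱ v) : IsStronglyProgressive ℱ fun t ω => u t ω + v t ω :=
  fun i => (hu i).add (hv i)

theorem prog_const_mul {u : Time T → Ω → ℝ} (c : ℝ) (hu : IsStronglyProgressive ℱ u) :
    IsStronglyProgressive ℱ fun t ω => c * u t ω :=
  fun i => (hu i).const_mul c

namespace AdmissibleProcess

theorem measurable (hT : 0 ≤ T) {u : Time T → Ω → ℝ} (hu : AdmissibleProcess P ℱ u) :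
    Measurable (Function.uncurry u) := measurable_uncurry_of_prog hT hu.prog

variable [IsProbabilityMeasure P]

theorem ae_memLp (hT : 0 ≤ T) {u : Time T → Ω → ℝ} (hu : AdmissibleProcess P ℱ u) :
    ∀ᵐ ω ∂P, MemLp (fun t => u t ω) 2 (leb T) := ae_memLp_path (hu.measurable hT) hu.sq_int

theorem memLp_path (hT : 0 ≤ T) {u : Time T → Ω → ℝ} (hu : AdmissibleProcess P ℱ u) :
    MemLp (path u) 2 P := StochGame.memLp_path (hu.measurable hT) hu.sq_int

theorem path_coe (hT : 0 ≤ T) {u : Time T → Ω → ℝ} (hu : AdmissibleProcess P ℱ u) :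
    ∀ᵐ ω ∂P, path u ω =ᵐ[leb T] fun t => u t ω := by
  filter_upwards [hu.ae_memLp hT] with ω hω
  exact coeFn_toL2 hω

theorem path_add (hT : 0 ≤ T) {u v : Time T → Ω → ℝ} (hu : AdmissibleProcess P ℱ u)
    (hv : AdmissibleProcess P ℱ v) :
    path (fun t ω => u t ω + v t ω) =ᵐ[P] path u + path v := by
  filter_upwards [hu.ae_memLp hT, hv.ae_memLp hT] with ω h1 h2
  exact toL2_add h1 h2

theorem path_sub (hT : 0 ≤ T) {u v : Time T → Ω → ℝ} (hu : AdmissibleProcess P ℱ u)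
    (hv : AdmissibleProcess P ℱ v) :
    path (fun t ω => u t ω - v t ω) =ᵐ[P] path u - path v := by
  filter_upwards [hu.ae_memLp hT, hv.ae_memLp hT] with ω h1 h2
  exact toL2_sub h1 h2

theorem path_const_mul (hT : 0 ≤ T) (c : ℝ) {u : Time T → Ω → ℝ} (hu : AdmissibleProcess P ℱ u) :
    path (fun t ω => c * u t ω) =ᵐ[P] c • path u := by
  filter_upwards [hu.ae_memLp hT] with ω h1
  exact toL2_const_mul c h1

theorem of_path (hT : 0 ≤ T) {u : Time T → Ω → ℝ} (hu : IsStronglyProgressive ℱ u)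
    {ψ : Ω → L2 T} (hψ : MemLp ψ 2 P)
    (h : ∀ᵐ ω ∂P, ψ ω =ᵐ[leb T] fun t => u t ω) : AdmissibleProcess P ℱ u :=
  ⟨hu, lintegral_sq_lt_top (measurable_uncurry_of_prog hT hu) hψ h⟩

theorem add (hT : 0 ≤ T) {u v : Time T → Ω → ℝ} (hu : AdmissibleProcess P ℱ u)
    (hv : AdmissibleProcess P ℱ v) : AdmissibleProcess P ℱ fun t ω => u t ω + v t ω := by
  refine of_path hT (prog_add hu.prog hv.prog) ((hu.memLp_path hT).add (hv.memLp_path hT)) ?_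
  filter_upwards [hu.path_coe hT, hv.path_coe hT] with ω h1 h2
  filter_upwards [h1, h2, Lp.coeFn_add (path u ω) (path v ω)] with t h3 h4 h5
  rw [Pi.add_apply, h5, Pi.add_apply, h3, h4]

theorem const_mul (hT : 0 ≤ T) (c : ℝ) {u : Time T → Ω → ℝ} (hu : AdmissibleProcess P ℱ u) :
    AdmissibleProcess P ℱ fun t ω => c * u t ω := by
  refine of_path hT (prog_const_mul c hu.prog) ((hu.memLp_path hT).const_smul c) ?_
  filter_upwards [hu.path_coe hT] with ω h1
  filter_upwards [h1, Lp.coeFn_smul c (path u ω)] with t h3 h5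
  rw [Pi.smul_apply, h5, Pi.smul_apply, h3, smul_eq_mul]

theorem sub (hT : 0 ≤ T) {u v : Time T → Ω → ℝ} (hu : AdmissibleProcess P ℱ u)
    (hv : AdmissibleProcess P ℱ v) : AdmissibleProcess P ℱ fun t ω => u t ω - v t ω := by
  have := hu.add hT (hv.const_mul hT (-1))
  simpa [sub_eq_add_neg] using this

theorem sum (hT : 0 ≤ T) {ι : Type*} (S : Finset ι) {u : ι → Time T → Ω → ℝ}
    (hu : ∀ i ∈ S, AdmissibleProcess P ℱ (u i)) :
    AdmissibleProcess P ℱ fun t ω => ∑ i ∈ S, u i t ω := by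
  classical
  induction S using Finset.induction_on with
  | empty =>
    simp only [Finset.sum_empty]
    exact ⟨fun i => stronglyMeasurable_const, by simp⟩
  | insert a S ha ih =>
    simp only [Finset.sum_insert ha]
    exact (hu a (by simp)).add hT (ih fun i hi => hu i (by simp [hi]))

theorem path_sum (hT : 0 ≤ T) {ι : Type*} (S : Finset ι) {u : ι → Time T → Ω → ℝ}
    (hu : ∀ i ∈ S, AdmissibleProcess P ℱ (u i)) :
    path (fun t ω => ∑ i ∈ S, u i t ω) =ᵐ[P] fun ω => ∑ i ∈ S, path (u i) ω := by
  classical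
  induction S using Finset.induction_on with
  | empty =>
    simp only [Finset.sum_empty]
    refine ae_of_all _ fun ω => ?_
    rw [path, toL2_of_memLp (f := fun _ => (0 : ℝ)) MemLp.zero]
    exact MemLp.toLp_zero _
  | insert a S ha ih =>
    simp only [Finset.sum_insert ha]
    have h1 : ∀ i ∈ S, AdmissibleProcess P ℱ (u i) := fun i hi => hu i (by simp [hi])
    filter_upwards [(hu a (by simp)).path_add hT (sum hT S h1), ih h1] with ω h2 h3
    rw [h2, Pi.add_apply, h3]

theorem avg (hT : 0 ≤ T) {N : ℕ} {u : Fin N → Time T → Ω → ℝ}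
    (hu : ∀ i, AdmissibleProcess P ℱ (u i)) : AdmissibleProcess P ℱ (StochGame.avg u) :=
  (sum hT Finset.univ fun i _ => hu i).const_mul hT _

theorem path_avg (hT : 0 ≤ T) {N : ℕ} {u : Fin N → Time T → Ω → ℝ}
    (hu : ∀ i, AdmissibleProcess P ℱ (u i)) :
    path (StochGame.avg u) =ᵐ[P] fun ω => (1 / (N : ℝ)) • ∑ i, path (u i) ω := by
  filter_upwards [(sum hT Finset.univ fun i _ => hu i).path_const_mul hT (1 / (N : ℝ)),
    path_sum hT Finset.univ fun i _ => hu i] with ω h1 h2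
  rw [Pi.smul_apply, h2] at h1
  exact h1

end AdmissibleProcess

end Progressive

/-! ### Restriction to `[t,T]` as an orthogonal projection -/

theorem measurable_ite_le {f : Time T → ℝ} (hf : Measurable f) (t : Time T) :
    Measurable fun s => if t ≤ s then f s else 0 :=
  Measurable.ite measurableSet_Ici hf measurable_const

theorem memLp_ite_le {f : Time T → ℝ} (t : Time T) (hf : MemLp f 2 (leb T)) :
    MemLp (fun s => if t ≤ s then f s else 0) 2 (leb T) := by
  have e : (fun s => if t ≤ s then f s else 0) = (Set.Ici t).indicator f := by
    funext s
    simp [Set.indicator_apply]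
  rw [e]
  exact hf.indicator measurableSet_Ici

theorem coeFn_restrictFrom (t : Time T) {f : Time T → ℝ} (hf : MemLp f 2 (leb T)) :
    restrictFrom t f =ᵐ[leb T] fun s => if t ≤ s then f s else 0 :=
  coeFn_toL2 (memLp_ite_le t hf)

theorem restrictFrom_congr (t : Time T) {f g : Time T → ℝ} (h : f =ᵐ[leb T] g) :
    restrictFrom t f = restrictFrom t g := by
  refine toL2_congr ?_
  filter_upwards [h] with s hs
  rw [hs]

theorem norm_restrictFrom_le (t : Time T) (f : L2 T) : ‖restrictFrom t f‖ ≤ ‖f‖ := by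
  refine Lp.norm_le_norm_of_ae_le ?_
  filter_upwards [coeFn_restrictFrom t (Lp.memLp f)] with s hs
  rw [hs]
  split_ifs
  · exact le_rfl
  · simp

/-- Multiplication by the indicator of `[t,T]`. -/
def projFrom (t : Time T) : L2 T →L[ℝ] L2 T :=
  LinearMap.mkContinuous
    { toFun := fun f => restrictFrom t f
      map_add' := fun f g => by
        rw [restrictFrom_congr t (Lp.coeFn_add f g), restrictFrom, restrictFrom, restrictFrom,
          ← toL2_add (memLp_ite_le t (Lp.memLp f)) (memLp_ite_le t (Lp.memLp g))]
        congr 1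
        funext s
        split_ifs <;> simp
      map_smul' := fun c f => by
        rw [RingHom.id_apply, restrictFrom_congr t (Lp.coeFn_smul c f), restrictFrom, restrictFrom,
          ← toL2_const_mul c (memLp_ite_le t (Lp.memLp f))]
        congr 1
        funext s
        split_ifs <;> simp }
    1 fun f => by
      rw [one_mul]
      exact norm_restrictFrom_le t f

theorem projFrom_apply (t : Time T) (f : L2 T) : projFrom t f = restrictFrom t f := rfl

theorem projFrom_toL2 (t : Time T) {f : Time T → ℝ} (hf : MemLp f 2 (leb T)) :
    projFrom t (toL2 f) = restrictFrom t f := by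
  rw [projFrom_apply]
  exact restrictFrom_congr t (coeFn_toL2 hf)

theorem coeFn_projFrom (t : Time T) (f : L2 T) :
    projFrom t f =ᵐ[leb T] fun s => if t ≤ s then f s else 0 :=
  coeFn_restrictFrom t (Lp.memLp f)

theorem norm_projFrom_le (t : Time T) (f : L2 T) : ‖projFrom t f‖ ≤ ‖f‖ := norm_restrictFrom_le t f

theorem projFrom_projFrom (t : Time T) (f : L2 T) : projFrom t (projFrom t f) = projFrom t f := by
  refine Lp.ext ?_
  filter_upwards [coeFn_projFrom t f, coeFn_projFrom t (projFrom t f)] with s h1 h2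
  rw [h2, h1]
  split_ifs <;> rfl

theorem inner_projFrom (t : Time T) (f g : L2 T) :
    inner ℝ (projFrom t f) g = inner ℝ f (projFrom t g) := by
  rw [inner_L2, inner_L2]
  refine integral_congr_ae ?_
  filter_upwards [coeFn_projFrom t f, coeFn_projFrom t g] with s h1 h2
  rw [h2, h1]
  split_ifs <;> simp

theorem coeFn_sub_projFrom (t : Time T) (f : L2 T) :
    ((f - projFrom t f : L2 T) : Time T → ℝ) =ᵐ[leb T] fun s => if s < t then f s else 0 := by
  filter_upwards [coeFn_projFrom t f, Lp.coeFn_sub f (projFrom t f)] with s h1 h2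
  rw [h2, Pi.sub_apply, h1]
  by_cases h : t ≤ s
  · simp [h, not_lt.2 h]
  · simp [h, not_le.1 h]

theorem norm_sq_L2 (f : L2 T) : ‖f‖ ^ 2 = ∫ s, f s ^ 2 ∂(leb T) := by
  rw [← real_inner_self_eq_norm_sq, inner_L2]
  simp_rw [sq]

theorem leb_singleton (t : Time T) : leb T {t} = 0 := by
  unfold leb
  rw [Measure.comap_apply _ Subtype.coe_injective
    (fun s hs => measurableSet_Icc.subtype_image hs) _ (measurableSet_singleton t)]
  simp

theorem integrable_sq_L2 (f : L2 T) : Integrable (fun s => f s ^ 2) (leb T) :=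
  (Lp.memLp f).integrable_sq

/-- Dominated convergence: the indicators of `[t,T]` converge as `t → t₀` at every point except
`t₀`, which is null. The continuity is strong, for each fixed `f`, and not in operator norm. -/
theorem continuous_projFrom (f : L2 T) : Continuous fun t : Time T => projFrom t f := by
  rw [continuous_iff_continuousAt]
  intro t₀
  rw [ContinuousAt, tendsto_iff_norm_sub_tendsto_zero]
  have h0 : ∀ᵐ s ∂(leb T), s ≠ t₀ := by
    rw [ae_iff]
    simpa using leb_singleton t₀
  have h : Tendsto (fun t => ‖projFrom t f - projFrom t₀ f‖ ^ 2) (nhds t₀) (nhds 0) := by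
    simp_rw [norm_sq_L2]
    have h2 : ∀ t, ∫ s, (projFrom t f - projFrom t₀ f : L2 T) s ^ 2 ∂(leb T) =
        ∫ s, ((if t ≤ s then f s else 0) - (if t₀ ≤ s then f s else 0)) ^ 2 ∂(leb T) := by
      intro t
      refine integral_congr_ae ?_
      filter_upwards [Lp.coeFn_sub (projFrom t f) (projFrom t₀ f), coeFn_projFrom t f,
        coeFn_projFrom t₀ f] with s h1 h2 h3
      rw [h1, Pi.sub_apply, h2, h3]
    simp_rw [h2]
    have h3 : Tendsto (fun t => ∫ s, ((if t ≤ s then f s else 0) -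
        (if t₀ ≤ s then f s else 0)) ^ 2 ∂(leb T)) (nhds t₀) (nhds (∫ s, (0 : ℝ) ∂(leb T))) := by
      refine tendsto_integral_filter_of_dominated_convergence (fun s => f s ^ 2) ?_ ?_
        (integrable_sq_L2 f) ?_
      · refine Eventually.of_forall fun t => ?_
        have hf := (Lp.stronglyMeasurable f).measurable
        exact (((measurable_ite_le hf t).sub (measurable_ite_le hf t₀)).pow_const 2).aestronglyMeasurable
      · refine Eventually.of_forall fun t => ae_of_all _ fun s => ?_
        rw [Real.norm_of_nonneg (sq_nonneg _)]
        split_ifs <;> simp [sq_nonneg]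
      · filter_upwards [h0] with s hs
        refine tendsto_const_nhds.congr' ?_
        rcases lt_or_gt_of_ne hs with h | h
        · filter_upwards [lt_mem_nhds h] with t ht
          simp [not_le.2 ht, not_le.2 h]
        · filter_upwards [gt_mem_nhds h] with t ht
          simp [ht.le, h.le]
    simpa using h3
  have := h.sqrt
  simpa [Real.sqrt_sq] using this

/-! ### Integral operators -/

theorem intOp_apply_toL2 {K : Kernel2 T} (hK : SqIntegrableKernel K) {f : Time T → ℝ}
    (hf : MemLp f 2 (leb T)) : intOp K (toL2 f) =ᵐ[leb T] fun s => ∫ u, K s u * f u ∂(leb T) := by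
  filter_upwards [intOp_apply hK (toL2 f)] with s hs
  rw [hs]
  refine integral_congr_ae ?_
  filter_upwards [coeFn_toL2 hf] with u hu
  rw [hu]

theorem SqIntegrableKernel.adj {K : Kernel2 T} (hK : SqIntegrableKernel K) :
    SqIntegrableKernel (adjKernel K) :=
  hK.comp_measurePreserving Measure.measurePreserving_swap

theorem SqIntegrableKernel.add {K L : Kernel2 T} (hK : SqIntegrableKernel K)
    (hL : SqIntegrableKernel L) : SqIntegrableKernel fun t s => K t s + L t s :=
  MemLp.add hK hL

theorem SqIntegrableKernel.const_mul {K : Kernel2 T} (c : ℝ) (hK : SqIntegrableKernel K) :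
    SqIntegrableKernel fun t s => c * K t s :=
  MemLp.const_mul hK c

theorem SqIntegrableKernel.trunc {K : Kernel2 T} (hK : SqIntegrableKernel K) (t : Time T) :
    SqIntegrableKernel (truncKernel K t) := by
  have e : Function.uncurry (truncKernel K t) =
      (Prod.snd ⁻¹' Set.Ici t).indicator (Function.uncurry K) := by
    funext p
    by_cases h : p ∈ Prod.snd ⁻¹' Set.Ici t
    · rw [Set.indicator_of_mem h]
      exact if_pos h
    · rw [Set.indicator_of_notMem h]
      exact if_neg h
  rw [SqIntegrableKernel, e]
  exact MemLp.indicator (measurable_snd measurableSet_Ici) hK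

theorem intOp_add {K L : Kernel2 T} (hK : SqIntegrableKernel K) (hL : SqIntegrableKernel L) :
    intOp (fun t s => K t s + L t s) = intOp K + intOp L := by
  refine ContinuousLinearMap.ext fun f => Lp.ext ?_
  filter_upwards [intOp_apply hK f, intOp_apply hL f, intOp_apply (hK.add hL) f,
    Lp.coeFn_add (intOp K f) (intOp L f), slices_memLp hK, slices_memLp hL]
    with s h1 h2 h3 h4 h5 h6
  rw [add_apply, h3, h4, Pi.add_apply, h1, h2]
  simp_rw [add_mul]
  exact integral_add (h5.integrable_mul (Lp.memLp f)) (h6.integrable_mul (Lp.memLp f))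

theorem intOp_const_mul {K : Kernel2 T} (c : ℝ) (hK : SqIntegrableKernel K) :
    intOp (fun t s => c * K t s) = c • intOp K := by
  refine ContinuousLinearMap.ext fun f => Lp.ext ?_
  filter_upwards [intOp_apply hK f, intOp_apply (hK.const_mul c) f,
    Lp.coeFn_smul c (intOp K f)] with s h1 h2 h3
  rw [smul_apply, h3, Pi.smul_apply, h1, h2, smul_eq_mul,
    ← integral_const_mul]
  simp_rw [mul_assoc]

theorem integrable_inner_kernel {K : Kernel2 T} (hK : SqIntegrableKernel K) (f g : L2 T) :
    Integrable (fun p : Time T × Time T => f p.1 * (K p.1 p.2 * g p.2))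
      ((leb T).prod (leb T)) := by
  have h1 : MemLp (fun p : Time T × Time T => f p.1 * g p.2) 2 ((leb T).prod (leb T)) := by
    refine (memLp_two_iff_integrable_sq ?_).2 ?_
    · exact ((Lp.aestronglyMeasurable f).comp_fst).mul ((Lp.aestronglyMeasurable g).comp_snd)
    · have := (integrable_sq_L2 f).mul_prod (integrable_sq_L2 g)
      simpa [mul_pow] using this
  refine (h1.integrable_mul (q := 2) hK).congr (ae_of_all _ fun p => ?_)
  simp only [Pi.mul_apply, Function.uncurry]
  ring

theorem inner_intOp {K : Kernel2 T} (hK : SqIntegrableKernel K) (f g : L2 T) :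
    inner ℝ f (intOp K g) = ∫ s, ∫ r, f s * (K s r * g r) ∂(leb T) ∂(leb T) := by
  rw [inner_L2]
  refine integral_congr_ae ?_
  filter_upwards [intOp_apply hK g] with s hs
  rw [hs, integral_const_mul]

theorem inner_intOp_adj {K : Kernel2 T} (hK : SqIntegrableKernel K) (f g : L2 T) :
    inner ℝ f (intOp (adjKernel K) g) = inner ℝ (intOp K f) g := by
  rw [real_inner_comm g, inner_intOp hK, inner_intOp hK.adj,
    integral_integral_swap (integrable_inner_kernel hK.adj f g)]
  refine integral_congr_ae (ae_of_all _ fun s => integral_congr_ae (ae_of_all _ fun r => ?_))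
  simp only [adjKernel]
  ring

/-- A kernel is of Volterra type if it vanishes above the diagonal. -/
def IsVolterra (K : Kernel2 T) : Prop := ∀ t s, t ≤ s → K t s = 0

theorem intOp_trunc {K : Kernel2 T} (hK : SqIntegrableKernel K) (t : Time T) :
    intOp (truncKernel K t) = (intOp K).comp (projFrom t) := by
  refine ContinuousLinearMap.ext fun f => Lp.ext ?_
  filter_upwards [intOp_apply (hK.trunc t) f, intOp_apply hK (projFrom t f)] with s h1 h2
  rw [h1, ContinuousLinearMap.comp_apply, h2]
  refine integral_congr_ae ?_
  filter_upwards [coeFn_projFrom t f] with u hu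
  rw [hu, truncKernel]
  split_ifs <;> simp

theorem intOp_adj_trunc {K : Kernel2 T} (hK : SqIntegrableKernel K) (t : Time T) :
    intOp (adjKernel (truncKernel K t)) = (projFrom t).comp (intOp (adjKernel K)) := by
  refine ContinuousLinearMap.ext fun f => ext_inner_left ℝ fun g => ?_
  rw [inner_intOp_adj (hK.trunc t), intOp_trunc hK, ContinuousLinearMap.comp_apply,
    ContinuousLinearMap.comp_apply, ← inner_projFrom, inner_intOp_adj hK]

/-- The output of a Volterra operator at time `s` uses only inputs before `s`, so functions
vanishing before `t` are mapped to such functions. -/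
theorem projFrom_intOp_projFrom {K : Kernel2 T} (hK : SqIntegrableKernel K) (hV : IsVolterra K)
    (t : Time T) (f : L2 T) : projFrom t (intOp K (projFrom t f)) = intOp K (projFrom t f) := by
  refine Lp.ext ?_
  filter_upwards [coeFn_projFrom t (intOp K (projFrom t f)), intOp_apply hK (projFrom t f)]
    with s h1 h2
  rw [h1]
  split_ifs with h
  · rfl
  · rw [h2, eq_comm]
    refine integral_eq_zero_of_ae ?_
    filter_upwards [coeFn_projFrom t f] with u hu
    rw [hu]
    split_ifs with h'
    · rw [hV s u ((not_le.1 h).le.trans h'), zero_mul, Pi.zero_apply]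
    · rw [mul_zero, Pi.zero_apply]

/-- The dual of the preceding invariance: on `[t,T]` the adjoint operator sees only inputs from
`[t,T]`. -/
theorem projFrom_intOp_adj_projFrom {K : Kernel2 T} (hK : SqIntegrableKernel K) (hV : IsVolterra K)
    (t : Time T) (f : L2 T) :
    projFrom t (intOp (adjKernel K) (projFrom t f)) = projFrom t (intOp (adjKernel K) f) := by
  refine ext_inner_left ℝ fun g => ?_
  rw [← inner_projFrom, ← inner_projFrom, inner_intOp_adj hK, inner_intOp_adj hK, ← inner_projFrom,
    projFrom_intOp_projFrom hK hV]

/-! ### Admissible kernels -/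

namespace AdmissibleKernel

theorem memLp_col {K : Kernel2 T} (hK : AdmissibleKernel K) (s : Time T) :
    MemLp (fun r => K r s) 2 (leb T) := by
  refine (memLp_two_iff_lintegral_sq
    (hK.measurable.comp (measurable_id.prodMk measurable_const)).aestronglyMeasurable).2 ?_
  refine lt_of_le_of_lt ?_ (lt_of_le_of_lt le_add_self hK.sup_lt_top)
  refine le_trans ?_ (le_iSup _ s)
  simp

theorem exists_col_bound {K : Kernel2 T} (hK : AdmissibleKernel K) :
    ∃ C, ∀ s, ‖toL2 fun r => K r s‖ ≤ C := by
  obtain ⟨M, hM⟩ := ENNReal.lt_iff_exists_nnreal_btwn.1 hK.sup_lt_top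
  refine ⟨Real.sqrt M, fun s => Real.le_sqrt_of_sq_le ?_⟩
  have h : ‖toL2 fun r => K r s‖ₑ ^ 2 ≤ M := by
    rw [enorm_toL2_sq (hK.memLp_col s)]
    refine le_trans ?_ hM.1.le
    refine le_trans ?_ le_add_self
    refine le_trans ?_ (le_iSup _ s)
    simp
  rw [enorm_eq_nnnorm] at h
  exact_mod_cast h

theorem sqIntegrable {K : Kernel2 T} (hK : AdmissibleKernel K) : SqIntegrableKernel K := by
  rw [SqIntegrableKernel, memLp_two_iff_lintegral_sq hK.measurable.aestronglyMeasurable,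
    lintegral_prod _ (hK.measurable.pow_const 2).ennreal_ofReal.aemeasurable]
  obtain ⟨M, hM⟩ := ENNReal.lt_iff_exists_nnreal_btwn.1 hK.sup_lt_top
  refine lt_of_le_of_lt (lintegral_mono (g := fun _ => (M : ℝ≥0∞)) fun t => ?_) ?_
  · refine le_trans ?_ hM.1.le
    refine le_trans ?_ le_self_add
    refine le_trans ?_ (le_iSup _ t)
    simp [Function.uncurry]
  · rw [lintegral_const]
    exact ENNReal.mul_lt_top (by simp) (measure_lt_top _ _)

/-- The symmetrised double integral in the definition is `⟨f, Kf⟩ + ⟨f, K*f⟩ = 2⟨f, Kf⟩`. -/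
theorem inner_nonneg {K : Kernel2 T} (hK : AdmissibleKernel K) (f : L2 T) :
    0 ≤ inner ℝ f (intOp K f) := by
  have h := hK.nonneg_definite f (Lp.memLp f)
  have h1 : inner ℝ f (intOp K f) + inner ℝ f (intOp (adjKernel K) f) =
      ∫ t, ∫ s, (K t s + K s t) * f s * f t ∂(leb T) ∂(leb T) := by
    rw [← inner_add_right, ← add_apply, ← intOp_add hK.sqIntegrable hK.sqIntegrable.adj,
      inner_intOp (hK.sqIntegrable.add hK.sqIntegrable.adj)]
    refine integral_congr_ae (ae_of_all _ fun s => integral_congr_ae (ae_of_all _ fun r => ?_))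
    simp only [adjKernel]
    ring
  rw [inner_intOp_adj hK.sqIntegrable, real_inner_comm] at h1
  rw [← h1] at h
  linarith [real_inner_comm f (intOp K f)]

end AdmissibleKernel

/-- The consequences of admissibility that are stable under nonnegative linear combinations. -/
structure GoodKernel (K : Kernel2 T) : Prop where
  measurable : Measurable (Function.uncurry K)
  volterra : IsVolterra K
  sqIntegrable : SqIntegrableKernel K
  memLp_col : ∀ s, MemLp (fun r => K r s) 2 (leb T)
  exists_col_bound : ∃ C, ∀ s, ‖toL2 fun r => K r s‖ ≤ C
  inner_nonneg : ∀ f : L2 T, 0 ≤ inner ℝ f (intOp K f)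

theorem AdmissibleKernel.good {K : Kernel2 T} (hK : AdmissibleKernel K) : GoodKernel K :=
  ⟨hK.measurable, hK.volterra, hK.sqIntegrable, hK.memLp_col, hK.exists_col_bound, hK.inner_nonneg⟩

namespace GoodKernel

theorem add {K L : Kernel2 T} (hK : GoodKernel K) (hL : GoodKernel L) :
    GoodKernel fun t s => K t s + L t s where
  measurable := hK.measurable.add hL.measurable
  volterra := fun t s h => by simp only [hK.volterra t s h, hL.volterra t s h, add_zero]
  sqIntegrable := hK.sqIntegrable.add hL.sqIntegrable
  memLp_col := fun s => (hK.memLp_col s).add (hL.memLp_col s)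
  exists_col_bound := by
    obtain ⟨C, hC⟩ := hK.exists_col_bound
    obtain ⟨C', hC'⟩ := hL.exists_col_bound
    refine ⟨C + C', fun s => ?_⟩
    rw [toL2_add (hK.memLp_col s) (hL.memLp_col s)]
    exact (norm_add_le _ _).trans (add_le_add (hC s) (hC' s))
  inner_nonneg := fun f => by
    rw [intOp_add hK.sqIntegrable hL.sqIntegrable, add_apply, inner_add_right]
    exact add_nonneg (hK.inner_nonneg f) (hL.inner_nonneg f)

theorem const_mul {K : Kernel2 T} (hK : GoodKernel K) {c : ℝ} (hc : 0 ≤ c) :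
    GoodKernel fun t s => c * K t s where
  measurable := hK.measurable.const_mul c
  volterra := fun t s h => by simp only [hK.volterra t s h, mul_zero]
  sqIntegrable := hK.sqIntegrable.const_mul c
  memLp_col := fun s => (hK.memLp_col s).const_mul c
  exists_col_bound := by
    obtain ⟨C, hC⟩ := hK.exists_col_bound
    refine ⟨|c| * C, fun s => ?_⟩
    rw [toL2_const_mul c (hK.memLp_col s), norm_smul]
    exact mul_le_mul_of_nonneg_left (hC s) (abs_nonneg c)
  inner_nonneg := fun f => by
    rw [intOp_const_mul c hK.sqIntegrable, smul_apply, inner_smul_right]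
    exact mul_nonneg hc (hK.inner_nonneg f)

end GoodKernel

section Combinations

variable {A1 A2hat A3 : Kernel2 T} (N : ℕ)

theorem good_kerG (h1 : GoodKernel A1) (h2 : GoodKernel A2hat) (h3 : GoodKernel A3) :
    GoodKernel (kerG N A1 A2hat A3) := by
  have := ((h1.const_mul (c := 1 / (N : ℝ) ^ 2) (by positivity)).add
    (h3.const_mul (c := 2 / N) (by positivity))).add h2
  convert this using 3
  rw [kerG]
  ring

theorem good_kerH (h1 : GoodKernel A1) (h3 : GoodKernel A3) : GoodKernel (kerH N A1 A3) := by
  have := (h1.const_mul (c := 1 / (N : ℝ)) (by positivity)).add h3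
  convert this using 3
  rw [kerH]
  ring

variable {N}

theorem good_kerKbar (hN : 1 ≤ N) (h1 : GoodKernel A1) (h2 : GoodKernel A2hat)
    (h3 : GoodKernel A3) : GoodKernel (kerKbar N A1 A2hat A3) := by
  have hN' : (1 : ℝ) ≤ N := by exact_mod_cast hN
  exact ((good_kerH N h1 h3).const_mul (c := ((N : ℝ) - 1) / N)
    (div_nonneg (by linarith) (by linarith))).add (good_kerG N h1 h2 h3)

/-- These are the coefficients that averaging the first-order conditions produces. -/
theorem kerKbar_eq (hN : 1 ≤ N) : kerKbar N A1 A2hat A3 =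
    fun t s => (1 / (N : ℝ)) * A1 t s + ((1 + 1 / (N : ℝ)) * A3 t s + A2hat t s) := by
  have hN' : (N : ℝ) ≠ 0 := by positivity
  funext t s
  rw [kerKbar, kerH, kerG]
  field_simp
  ring

end Combinations

/-! ### The operators `2λ + K P_t + P_t K*` -/

/-- The operator `2λ + K P_t + P_t K*`. -/
def truncSymOp (lam : ℝ) (K : Kernel2 T) (t : Time T) : L2 T →L[ℝ] L2 T :=
  (2 * lam) • ContinuousLinearMap.id ℝ (L2 T) + (intOp K).comp (projFrom t)
    + (projFrom t).comp (intOp (adjKernel K))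

/-- `H` and `G` enter only through `K̄`; truncating a kernel in its second variable is
precomposition with the projection, and on the adjoint side postcomposition. -/
theorem opDbar_eq {A1 A2hat A3 : Kernel2 T} {N : ℕ} (h1 : GoodKernel A1)
    (h2 : GoodKernel A2hat) (h3 : GoodKernel A3) (lam : ℝ) (t : Time T) :
    opDbar N lam A1 A2hat A3 t = truncSymOp lam (kerKbar N A1 A2hat A3) t := by
  have hH := (good_kerH N h1 h3).sqIntegrable
  have hG := (good_kerG N h1 h2 h3).sqIntegrable
  have e1 : intOp (kerKbar N A1 A2hat A3) = (((N : ℝ) - 1) / N) • intOp (kerH N A1 A3) +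
      intOp (kerG N A1 A2hat A3) := by
    rw [← intOp_const_mul _ hH, ← intOp_add (hH.const_mul _) hG]
    rfl
  have e2 : intOp (adjKernel (kerKbar N A1 A2hat A3)) =
      (((N : ℝ) - 1) / N) • intOp (adjKernel (kerH N A1 A3)) +
      intOp (adjKernel (kerG N A1 A2hat A3)) := by
    rw [← intOp_const_mul _ hH.adj, ← intOp_add (hH.adj.const_mul _) hG.adj]
    rfl
  rw [opDbar, truncSymOp, intOp_trunc hH, intOp_trunc hG, intOp_adj_trunc hH, intOp_adj_trunc hG,
    e1, e2]
  refine ContinuousLinearMap.ext fun f => ?_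
  simp only [add_apply, smul_apply, ContinuousLinearMap.comp_apply, map_add, map_smul, smul_add]
  abel

namespace GoodKernel

variable {K : Kernel2 T} {lam : ℝ}

theorem inner_truncSymOp_right (hK : GoodKernel K) (lam : ℝ) (t : Time T) (f g : L2 T) :
    inner ℝ f (truncSymOp lam K t g) = inner ℝ (truncSymOp lam K t f) g := by
  simp only [truncSymOp, add_apply, smul_apply, ContinuousLinearMap.comp_apply,
    ContinuousLinearMap.id_apply, inner_add_left, inner_add_right, inner_smul_left,
    inner_smul_right]
  rw [← inner_projFrom, inner_intOp_adj hK.sqIntegrable, inner_projFrom t (intOp (adjKernel K) f),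
    real_inner_comm _ (intOp (adjKernel K) f), inner_intOp_adj hK.sqIntegrable,
    real_inner_comm f]
  simp only [conj_trivial]
  ring

/-- Coercivity. Since `K P_t = P_t K P_t`, each of the two nonlocal terms contributes `⟨P_t f, K P_t
f⟩ ≥ 0`. -/
theorem inner_truncSymOp_self (hK : GoodKernel K) (lam : ℝ) (t : Time T) (f : L2 T) :
    2 * lam * ‖f‖ ^ 2 ≤ inner ℝ f (truncSymOp lam K t f) := by
  simp only [truncSymOp, add_apply, smul_apply, ContinuousLinearMap.comp_apply,
    ContinuousLinearMap.id_apply, inner_add_right, inner_smul_right]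
  rw [← inner_projFrom, inner_intOp_adj hK.sqIntegrable, real_inner_self_eq_norm_sq,
    ← projFrom_intOp_projFrom hK.sqIntegrable hK.volterra, inner_projFrom,
    ← inner_projFrom, real_inner_comm (projFrom t f)]
  have h := hK.inner_nonneg (projFrom t f)
  linarith

theorem norm_le_norm_truncSymOp (hK : GoodKernel K) (lam : ℝ) (t : Time T) (f : L2 T) :
    2 * lam * ‖f‖ ≤ ‖truncSymOp lam K t f‖ := by
  by_cases hf : ‖f‖ = 0
  · rw [hf, mul_zero]
    exact norm_nonneg _
  have h1 := hK.inner_truncSymOp_self lam t f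
  have h2 := real_inner_le_norm f (truncSymOp lam K t f)
  have h3 : 0 < ‖f‖ := lt_of_le_of_ne (norm_nonneg _) (Ne.symm hf)
  nlinarith

theorem isUnit_truncSymOp (hK : GoodKernel K) (hlam : 0 < lam) (t : Time T) : IsUnit (truncSymOp lam K t) := by
  refine ContinuousLinearMap.isUnit_of_forall_le_norm_inner_map (truncSymOp lam K t)
    (c := Real.toNNReal (2 * lam)) (Real.toNNReal_pos.2 (by positivity)) fun f => ?_
  rw [real_inner_comm, Real.coe_toNNReal _ (by positivity)]
  refine le_trans ?_ (le_abs_self _)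
  rw [mul_comm]
  exact hK.inner_truncSymOp_self lam t f

theorem truncSymOp_inverse (hK : GoodKernel K) (hlam : 0 < lam) (t : Time T) (f : L2 T) :
    truncSymOp lam K t (Ring.inverse (truncSymOp lam K t) f) = f := by
  have := Ring.mul_inverse_cancel _ (hK.isUnit_truncSymOp hlam t)
  exact congrArg (fun A : L2 T →L[ℝ] L2 T => A f) this

theorem inverse_truncSymOp (hK : GoodKernel K) (hlam : 0 < lam) (t : Time T) (f : L2 T) :
    Ring.inverse (truncSymOp lam K t) (truncSymOp lam K t f) = f := by
  have := Ring.inverse_mul_cancel _ (hK.isUnit_truncSymOp hlam t)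
  exact congrArg (fun A : L2 T →L[ℝ] L2 T => A f) this

theorem norm_inverse_truncSymOp_le (hK : GoodKernel K) (hlam : 0 < lam) (t : Time T) (f : L2 T) :
    ‖Ring.inverse (truncSymOp lam K t) f‖ ≤ (2 * lam)⁻¹ * ‖f‖ := by
  have h := hK.norm_le_norm_truncSymOp lam t (Ring.inverse (truncSymOp lam K t) f)
  rw [hK.truncSymOp_inverse hlam] at h
  rw [inv_mul_eq_div, le_div_iff₀ (by positivity)]
  linarith

theorem inner_inverse_truncSymOp (hK : GoodKernel K) (hlam : 0 < lam) (t : Time T) (f g : L2 T) :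
    inner ℝ f (Ring.inverse (truncSymOp lam K t) g) =
      inner ℝ (Ring.inverse (truncSymOp lam K t) f) g := by
  conv_lhs => rw [← hK.truncSymOp_inverse hlam t f]
  rw [← hK.inner_truncSymOp_right, hK.truncSymOp_inverse hlam]

theorem continuous_truncSymOp (lam : ℝ) (K : Kernel2 T) (f : L2 T) :
    Continuous fun t => truncSymOp lam K t f := by
  simp only [truncSymOp, add_apply, smul_apply, ContinuousLinearMap.comp_apply,
    ContinuousLinearMap.id_apply]
  exact (continuous_const.add ((intOp K).continuous.comp (continuous_projFrom f))).add
    (continuous_projFrom _)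

/-- With `y = D_{t₀}⁻¹ f`, the difference of the inverses at `f` is `D_t⁻¹ (D_{t₀} - D_t) y`; the
bound `1/(2λ)` on `D_t⁻¹` is uniform and `D_t y` is continuous in `t`. -/
theorem continuous_inverse_truncSymOp (hK : GoodKernel K) (hlam : 0 < lam) (f : L2 T) :
    Continuous fun t => Ring.inverse (truncSymOp lam K t) f := by
  rw [continuous_iff_continuousAt]
  intro t₀
  rw [ContinuousAt, tendsto_iff_norm_sub_tendsto_zero]
  set y := Ring.inverse (truncSymOp lam K t₀) f with hy
  have hf : f = truncSymOp lam K t₀ y := (hK.truncSymOp_inverse hlam t₀ f).symm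
  have h1 : Tendsto (fun t => (2 * lam)⁻¹ * ‖truncSymOp lam K t₀ y - truncSymOp lam K t y‖)
      (nhds t₀) (nhds 0) := by
    have h2 := ((continuous_const (y := truncSymOp lam K t₀ y)).sub
      (continuous_truncSymOp lam K y)).norm.const_mul ((2 * lam)⁻¹)
    simpa using h2.tendsto t₀
  refine squeeze_zero (fun _ => norm_nonneg _) (fun t => ?_) h1
  refine le_trans (le_of_eq ?_) (hK.norm_inverse_truncSymOp_le hlam t _)
  rw [map_sub, ← hf, hK.inverse_truncSymOp hlam]

/-- Joint continuity is what makes `t ↦ D_t⁻¹ K(·,t)` measurable, where operator and argument vary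
together. It follows from continuity in `t` and a Lipschitz bound uniform in `t`. -/
theorem continuous_uncurry_inverse_truncSymOp (hK : GoodKernel K) (hlam : 0 < lam) :
    Continuous fun p : Time T × L2 T => Ring.inverse (truncSymOp lam K p.1) p.2 := by
  refine continuous_prod_of_continuous_lipschitzWith' _ (Real.toNNReal (2 * lam)⁻¹)
    (fun t => ?_) fun f => hK.continuous_inverse_truncSymOp hlam f
  refine LipschitzWith.of_dist_le_mul fun f g => ?_
  rw [dist_eq_norm, dist_eq_norm, ← map_sub, Real.coe_toNNReal _ (by positivity)]
  exact hK.norm_inverse_truncSymOp_le hlam t _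

end GoodKernel

theorem continuous_uncurry_projFrom :
    Continuous fun p : Time T × L2 T => projFrom p.1 p.2 := by
  refine continuous_prod_of_continuous_lipschitzWith' _ 1 (fun t => ?_)
    fun f => continuous_projFrom f
  refine LipschitzWith.of_dist_le_mul fun f g => ?_
  rw [dist_eq_norm, dist_eq_norm, ← map_sub, NNReal.coe_one, one_mul]
  exact norm_projFrom_le t _

/-! ### Resolvents of square-integrable Volterra kernels -/

/-- The kernel `e^{-β(t-s)} K(t,s)`. -/
def expKernel (β : ℝ) (K : Kernel2 T) : Kernel2 T :=
  fun t s => Real.exp (-(β * ((t : ℝ) - s))) * K t s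

theorem abs_expKernel_le {K : Kernel2 T} (hV : IsVolterra K) {β : ℝ} (hβ : 0 ≤ β) (t s : Time T) :
    |expKernel β K t s| ≤ |K t s| := by
  rw [expKernel, abs_mul, abs_of_pos (Real.exp_pos _)]
  rcases le_or_gt t s with h | h
  · rw [hV t s h, abs_zero, mul_zero]
  · have h' : (0 : ℝ) ≤ (t : ℝ) - s := sub_nonneg.2 (Subtype.coe_le_coe.2 h.le)
    refine mul_le_of_le_one_left (abs_nonneg _) (Real.exp_le_one_iff.2 ?_)
    have := mul_nonneg hβ h'
    linarith

theorem aestronglyMeasurable_expKernel {K : Kernel2 T} (hK : SqIntegrableKernel K) (β : ℝ) :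
    AEStronglyMeasurable (Function.uncurry (expKernel β K)) ((leb T).prod (leb T)) := by
  have h : Measurable fun p : Time T × Time T => Real.exp (-(β * ((p.1 : ℝ) - p.2))) := by
    fun_prop
  exact h.aestronglyMeasurable.mul hK.1

theorem sqIntegrable_expKernel {K : Kernel2 T} (hK : SqIntegrableKernel K) (hV : IsVolterra K)
    {β : ℝ} (hβ : 0 ≤ β) : SqIntegrableKernel (expKernel β K) :=
  MemLp.of_le hK (aestronglyMeasurable_expKernel hK β)
    (ae_of_all _ fun p => abs_expKernel_le hV hβ p.1 p.2)

/-- Dominated convergence: strictly below the diagonal the exponential factor tends to zero, and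
elsewhere the kernel vanishes. -/
theorem tendsto_integral_expKernel_sq {K : Kernel2 T} (hK : SqIntegrableKernel K)
    (hV : IsVolterra K) :
    Tendsto (fun n : ℕ => ∫ p, Function.uncurry (expKernel (n : ℝ) K) p ^ 2
      ∂((leb T).prod (leb T))) atTop (nhds 0) := by
  have hK' : MemLp (Function.uncurry K) 2 ((leb T).prod (leb T)) := hK
  have := tendsto_integral_of_dominated_convergence (μ := (leb T).prod (leb T))
    (F := fun (n : ℕ) p => Function.uncurry (expKernel (n : ℝ) K) p ^ 2) (f := fun _ => (0 : ℝ))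
    (fun p => Function.uncurry K p ^ 2)
    (fun n => (aestronglyMeasurable_expKernel hK n).pow 2) hK'.integrable_sq
    (fun n => ae_of_all _ fun p => by
      rw [Real.norm_of_nonneg (sq_nonneg _)]
      exact sq_le_sq.2 (abs_expKernel_le hV n.cast_nonneg p.1 p.2))
    (ae_of_all _ fun p => by
      rcases le_or_gt p.1 p.2 with h | h
      · simp [Function.uncurry, expKernel, hV p.1 p.2 h]
      · have h' : (0 : ℝ) < (p.1 : ℝ) - p.2 := sub_pos.2 (Subtype.coe_lt_coe.2 h)
        have h1 : Tendsto (fun n : ℕ => Real.exp (-((n : ℝ) * ((p.1 : ℝ) - p.2)))) atTop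
            (nhds 0) :=
          Real.tendsto_exp_neg_atTop_nhds_zero.comp
            (tendsto_natCast_atTop_atTop.atTop_mul_const h')
        simpa [Function.uncurry, expKernel] using (h1.mul_const (K p.1 p.2)).pow 2)
  simpa using this

/-- The weighted function `e^{-β t} f(t)`. -/
def expWeight (β : ℝ) (f : L2 T) : L2 T := toL2 fun t => Real.exp (-(β * t)) * f t

theorem memLp_expWeight (β : ℝ) (f : L2 T) :
    MemLp (fun t : Time T => Real.exp (-(β * t)) * f t) 2 (leb T) := by
  have h1 : Measurable fun t : Time T => Real.exp (-(β * t)) := by fun_prop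
  refine MemLp.of_le (g := fun t : Time T => Real.exp (|β| * T) * f t)
    ((Lp.memLp f).const_mul _)
    (h1.aestronglyMeasurable.mul (Lp.aestronglyMeasurable f)) (ae_of_all _ fun t => ?_)
  rw [norm_mul, norm_mul, Real.norm_of_nonneg (Real.exp_pos _).le,
    Real.norm_of_nonneg (Real.exp_pos _).le]
  refine mul_le_mul_of_nonneg_right (Real.exp_le_exp.2 ?_) (norm_nonneg _)
  calc -(β * t) ≤ |β| * t := by
        rw [← neg_mul]
        exact mul_le_mul_of_nonneg_right (neg_le_abs β) t.2.1
    _ ≤ |β| * T := mul_le_mul_of_nonneg_left t.2.2 (abs_nonneg β)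

theorem norm_expWeight_le {β : ℝ} (hβ : 0 ≤ β) (f : L2 T) : ‖expWeight β f‖ ≤ ‖f‖ := by
  refine Lp.norm_le_norm_of_ae_le ?_
  filter_upwards [coeFn_toL2 (memLp_expWeight β f)] with t ht
  rw [expWeight, ht, norm_mul, Real.norm_of_nonneg (Real.exp_pos _).le]
  refine mul_le_of_le_one_left (norm_nonneg _) (Real.exp_le_one_iff.2 ?_)
  have := mul_nonneg hβ t.2.1
  linarith

theorem norm_le_expWeight {β : ℝ} (hβ : 0 ≤ β) (f : L2 T) :
    ‖f‖ ≤ Real.exp (β * T) * ‖expWeight β f‖ := by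
  refine Lp.norm_le_mul_norm_of_ae_le_mul ?_
  filter_upwards [coeFn_toL2 (memLp_expWeight β f)] with t ht
  rw [expWeight, ht, norm_mul, Real.norm_of_nonneg (Real.exp_pos _).le, ← mul_assoc,
    ← Real.exp_add]
  refine le_mul_of_one_le_left (norm_nonneg _) (Real.one_le_exp ?_)
  have := mul_le_mul_of_nonneg_left t.2.2 hβ
  linarith

/-- Conjugating `K` by the weight `e^{-βt}` gives the operator of `expKernel β K`, to which the
Hilbert–Schmidt bound applies. -/
theorem norm_expWeight_intOp_le {K : Kernel2 T} (hK : SqIntegrableKernel K) (hV : IsVolterra K)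
    {β : ℝ} (hβ : 0 ≤ β) (f : L2 T) :
    ‖expWeight β (intOp K f)‖ ^ 2 ≤
      (∫ p, Function.uncurry (expKernel β K) p ^ 2 ∂((leb T).prod (leb T))) *
        ‖expWeight β f‖ ^ 2 := by
  refine le_trans (le_of_eq ?_)
    (kernelApply_bound (sqIntegrable_expKernel hK hV hβ) (expWeight β f)).2
  rw [norm_sq_L2]
  refine integral_congr_ae ?_
  filter_upwards [coeFn_toL2 (memLp_expWeight β (intOp K f)), intOp_apply hK f] with t h1 h2
  rw [expWeight, h1, h2, ← integral_const_mul, kernelApply]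
  congr 1
  refine integral_congr_ae ?_
  filter_upwards [coeFn_toL2 (memLp_expWeight β f)] with s h3
  rw [expWeight, h3, expKernel]
  have : Real.exp (-(β * t)) = Real.exp (-(β * ((t : ℝ) - s))) * Real.exp (-(β * s)) := by
    rw [← Real.exp_add]
    congr 1
    ring
  rw [this]
  ring

/-- For large `β` the operator halves the weighted norm, which is equivalent to the original one, so
some power has norm below `1`. -/
theorem isUnit_id_sub_intOp {K : Kernel2 T} (hK : SqIntegrableKernel K) (hV : IsVolterra K) :
    IsUnit (ContinuousLinearMap.id ℝ (L2 T) - intOp K) := by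
  -- The bound `1 / 4` is on the squared Hilbert–Schmidt norm and gives the contraction factor `1 /
  -- 2`.
  obtain ⟨β, hβ, hm⟩ : ∃ β : ℝ, 0 ≤ β ∧
      ∫ p, Function.uncurry (expKernel β K) p ^ 2 ∂((leb T).prod (leb T)) < 1 / 4 := by
    obtain ⟨m, hm⟩ := ((tendsto_integral_expKernel_sq hK hV).eventually
      (gt_mem_nhds (show (0 : ℝ) < 1 / 4 by norm_num))).exists
    exact ⟨m, m.cast_nonneg, hm⟩
  have h1 : ∀ f, ‖expWeight β (intOp K f)‖ ≤ (1 / 2) * ‖expWeight β f‖ := by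
    intro f
    have h := norm_expWeight_intOp_le hK hV hβ f
    have h2 : ‖expWeight β (intOp K f)‖ ^ 2 ≤ ((1 / 2) * ‖expWeight β f‖) ^ 2 := by
      refine h.trans ?_
      rw [mul_pow]
      refine mul_le_mul_of_nonneg_right ?_ (sq_nonneg _)
      norm_num at hm ⊢
      exact hm.le
    exact le_of_sq_le_sq h2 (by positivity)
  have h2 : ∀ n f, ‖expWeight β ((intOp K ^ n) f)‖ ≤ (1 / 2) ^ n * ‖expWeight β f‖ := by
    intro n
    induction n with
    | zero => intro f; simp
    | succ n ih =>
      intro f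
      rw [pow_succ]
      refine (ih (intOp K f)).trans ?_
      rw [pow_succ, mul_assoc]
      exact mul_le_mul_of_nonneg_left (h1 f) (by positivity)
  have h3 : ∀ n, ‖intOp K ^ n‖ ≤ Real.exp (β * T) * (1 / 2) ^ n := by
    intro n
    refine ContinuousLinearMap.opNorm_le_bound _ (by positivity) fun f => ?_
    refine (norm_le_expWeight hβ _).trans ?_
    rw [mul_assoc]
    refine mul_le_mul_of_nonneg_left ((h2 n f).trans ?_) (Real.exp_pos _).le
    exact mul_le_mul_of_nonneg_left (norm_expWeight_le hβ f) (by positivity)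
  have h4 : Tendsto (fun n : ℕ => Real.exp (β * T) * (1 / 2 : ℝ) ^ n) atTop (nhds 0) := by
    simpa using (tendsto_pow_atTop_nhds_zero_of_lt_one (by norm_num : (0 : ℝ) ≤ 1 / 2)
      (by norm_num)).const_mul (Real.exp (β * T))
  obtain ⟨n, hn⟩ := (h4.eventually (gt_mem_nhds zero_lt_one)).exists
  have h5 : IsUnit (1 - intOp K ^ n) := isUnit_one_sub_of_norm_lt_one ((h3 n).trans_lt hn)
  rw [← mul_neg_geom_sum] at h5
  -- In `1 - Kⁿ = (1 - K)(1 + K + ⋯ + Kⁿ⁻¹)` the factors commute, so invertibility of the product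
  -- passes to `1 - K`.
  have hc : Commute (1 - intOp K) (∑ i ∈ Finset.range n, intOp K ^ i) :=
    (Commute.sum_right _ _ _ fun i _ =>
      ((Commute.one_left _).sub_left ((Commute.refl _).pow_right i)))
  exact (hc.isUnit_mul_iff.1 h5).1

/-! ### The feedback kernel -/

/-- The column `K(·,s)` in `L²`. -/
def col (K : Kernel2 T) (s : Time T) : L2 T := toL2 fun r => K r s

/-- The vector `h_t = P_t D_t⁻¹ K(·,t)`. -/
def gainVec (lam : ℝ) (K : Kernel2 T) (t : Time T) : L2 T :=
  projFrom t (Ring.inverse (truncSymOp lam K t) (col K t))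

/-- The kernel `B(t,s) = 1_{s<t} (⟨h_t, K(·,s)⟩ - K(t,s)) / (2λ)`. -/
def feedbackKernel (lam : ℝ) (K : Kernel2 T) : Kernel2 T := fun t s =>
  if s < t then 1 / (2 * lam) * (inner ℝ (gainVec lam K t) (col K s) - K t s) else 0

theorem isVolterra_feedbackKernel (lam : ℝ) (K : Kernel2 T) : IsVolterra (feedbackKernel lam K) :=
  fun _ _ h => if_neg (not_lt.2 h)

namespace GoodKernel

variable {K : Kernel2 T} {lam : ℝ}

theorem restrictFrom_col (hK : GoodKernel K) (t s : Time T) :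
    (restrictFrom t fun r => K r s) = projFrom t (col K s) :=
  (projFrom_toL2 t (hK.memLp_col s)).symm

theorem projFrom_col (hK : GoodKernel K) (t : Time T) : projFrom t (col K t) = col K t := by
  rw [← hK.restrictFrom_col, restrictFrom, col]
  congr 1
  funext r
  split_ifs with h
  · rfl
  · rw [hK.volterra r t (not_le.1 h).le]

/-- Self-adjointness moves `D_t⁻¹` onto the column, so the inner products in `ā` and `B̄` are both
pairings with the single vector `h_t`. -/
theorem inner_inverse_projFrom (hK : GoodKernel K) (hlam : 0 < lam) (t : Time T) (g : L2 T) :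
    inner ℝ (restrictFrom t fun r => K r t) (Ring.inverse (truncSymOp lam K t) (projFrom t g)) =
      inner ℝ (gainVec lam K t) g := by
  rw [hK.restrictFrom_col, hK.projFrom_col, hK.inner_inverse_truncSymOp hlam, gainVec,
    inner_projFrom]

theorem stronglyMeasurable_col (hK : GoodKernel K) : StronglyMeasurable (col K) :=
  stronglyMeasurable_toL2 hK.measurable

theorem stronglyMeasurable_gainVec (hK : GoodKernel K) (hlam : 0 < lam) :
    StronglyMeasurable (gainVec lam K) := by
  have h1 : StronglyMeasurable fun t : Time T => t := measurable_id.stronglyMeasurable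
  have h2 := (hK.continuous_uncurry_inverse_truncSymOp hlam).comp_stronglyMeasurable
    (h1.prodMk hK.stronglyMeasurable_col)
  exact continuous_uncurry_projFrom.comp_stronglyMeasurable (h1.prodMk h2)

theorem exists_gainVec_bound (hK : GoodKernel K) (hlam : 0 < lam) :
    ∃ C, 0 ≤ C ∧ ∀ t, ‖gainVec lam K t‖ ≤ C := by
  obtain ⟨C, hC⟩ := hK.exists_col_bound
  refine ⟨(2 * lam)⁻¹ * max C 0, by positivity, fun t => ?_⟩
  refine (norm_projFrom_le t _).trans ((hK.norm_inverse_truncSymOp_le hlam t _).trans ?_)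
  exact mul_le_mul_of_nonneg_left ((hC t).trans (le_max_left _ _)) (by positivity)

theorem measurable_feedbackKernel (hK : GoodKernel K) (hlam : 0 < lam) :
    Measurable (Function.uncurry (feedbackKernel lam K)) := by
  refine Measurable.ite (measurableSet_lt measurable_snd measurable_fst) ?_ measurable_const
  refine Measurable.const_mul (Measurable.sub ?_ hK.measurable) _
  exact (((hK.stronglyMeasurable_gainVec hlam).comp_measurable measurable_fst).inner
    (hK.stronglyMeasurable_col.comp_measurable measurable_snd)).measurable

/-- `h_t` and the columns of `K` are uniformly bounded in `L²`, so the inner product part is bounded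
and only `K` itself remains. -/
theorem sqIntegrable_feedbackKernel (hK : GoodKernel K) (hlam : 0 < lam) :
    SqIntegrableKernel (feedbackKernel lam K) := by
  obtain ⟨C, hC0, hC⟩ := hK.exists_gainVec_bound hlam
  obtain ⟨C', hC'⟩ := hK.exists_col_bound
  have hK' : MemLp (Function.uncurry K) 2 ((leb T).prod (leb T)) := hK.sqIntegrable
  refine MemLp.of_le (g := fun p => 1 / (2 * lam) * (C * C' + ‖Function.uncurry K p‖))
    (((memLp_const (C * C')).add hK'.norm).const_mul (1 / (2 * lam)))
    (hK.measurable_feedbackKernel hlam).aestronglyMeasurable (ae_of_all _ fun p => ?_)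
  have hC0' : 0 ≤ C' := (norm_nonneg _).trans (hC' p.2)
  rw [Real.norm_of_nonneg (r := 1 / (2 * lam) * _) (by positivity)]
  simp only [Function.uncurry, feedbackKernel]
  split_ifs
  · rw [norm_mul, Real.norm_of_nonneg (by positivity)]
    refine mul_le_mul_of_nonneg_left ((norm_sub_le _ _).trans ?_) (by positivity)
    gcongr
    refine (norm_inner_le_norm _ _).trans ?_
    exact mul_le_mul (hC _) (hC' _) (norm_nonneg _) hC0
  · rw [norm_zero]
    positivity

end GoodKernel

theorem kerBbar_eq {A1 A2hat A3 : Kernel2 T} {N : ℕ} (hN : 1 ≤ N) (h1 : GoodKernel A1)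
    (h2 : GoodKernel A2hat) (h3 : GoodKernel A3) {lam : ℝ} (hlam : 0 < lam) :
    kerBbar N lam A1 A2hat A3 = feedbackKernel lam (kerKbar N A1 A2hat A3) := by
  have hK := good_kerKbar hN h1 h2 h3
  funext t s
  rw [kerBbar, feedbackKernel]
  split_ifs
  · rw [opDbar_eq h1 h2 h3, hK.restrictFrom_col t s, hK.inner_inverse_projFrom hlam]
  · rfl

/-! ### Progressive versions of closed martingales -/

/-- A monotone `g` may jump, so a dense set alone cannot approximate from the left within `ε`. Cut
the range into cells of length `ε` and add to a countable dense set the least element of each `I j`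
that has one, at most one per cell. A point that is not least in its cell has a smaller point in the
same cell, and by monotonicity a dense point strictly between them lies there too. -/
theorem exists_seq_left_approx (hT : 0 ≤ T) {g : Time T → ℝ} (hg : Monotone g) {ε : ℝ}
    (hε : 0 < ε) : ∃ q : ℕ → Time T, ∀ u, ∃ n, q n ≤ u ∧ g u ≤ g (q n) + ε := by
  obtain ⟨D, hDc, hD⟩ := TopologicalSpace.exists_countable_dense (Time T)
  set I : ℤ → Set (Time T) := fun j => {u | ⌊g u / ε⌋ = j}
  set S : Set (Time T) := D ∪ ⋃ j, {m | IsLeast (I j) m}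
  have hS : S.Countable := by
    refine hDc.union (Set.countable_iUnion fun j => Set.Subsingleton.countable ?_)
    intro a ha b hb
    exact IsLeast.unique ha hb
  have hfloor : ∀ u v : Time T, ⌊g u / ε⌋ = ⌊g v / ε⌋ → g u ≤ g v + ε := by
    intro u v h
    have h1 := Int.abs_sub_lt_one_of_floor_eq_floor h
    rw [← sub_div, abs_div, abs_of_pos hε, div_lt_one hε] at h1
    linarith [le_abs_self (g u - g v)]
  have key : ∀ u, ∃ q ∈ S, q ≤ u ∧ g u ≤ g q + ε := by
    intro u
    by_cases hu : IsLeast (I ⌊g u / ε⌋) u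
    · exact ⟨u, Or.inr (Set.mem_iUnion.2 ⟨_, hu⟩), le_rfl, by linarith⟩
    · have : ∃ v ∈ I ⌊g u / ε⌋, v < u := by
        by_contra! hc
        exact hu ⟨rfl, hc⟩
      obtain ⟨v, hv, hvu⟩ := this
      obtain ⟨d, hd, hd1, hd2⟩ := hD.exists_between hvu
      refine ⟨d, Or.inl hd, hd2.le, hfloor _ _ (le_antisymm ?_ ?_)⟩
      · rw [← show ⌊g v / ε⌋ = ⌊g u / ε⌋ from hv]
        exact Int.floor_le_floor (div_le_div_of_nonneg_right (hg hd1.le) hε.le)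
      · exact Int.floor_le_floor (div_le_div_of_nonneg_right (hg hd2.le) hε.le)
  obtain ⟨q, hq⟩ := hS.exists_eq_range ((key ⟨0, le_rfl, hT⟩).imp fun _ h => h.1)
  refine ⟨q, fun u => ?_⟩
  obtain ⟨x, hx, h⟩ := key u
  rw [hq] at hx
  obtain ⟨n, rfl⟩ := hx
  exact ⟨n, h⟩

section CondExp

variable {Ω H : Type*} [mΩ : MeasurableSpace Ω] {P : Measure Ω}
  [NormedAddCommGroup H] [InnerProductSpace ℝ H] [CompleteSpace H]

/-- Pythagoras for nested orthogonal projections. -/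
theorem norm_condExpL2_sub_sq {m₁ m₂ : MeasurableSpace Ω} (h12 : m₁ ≤ m₂) (h2 : m₂ ≤ mΩ)
    (f : Lp H 2 P) :
    ‖(condExpL2 H ℝ h2 f : Lp H 2 P) - (condExpL2 H ℝ (h12.trans h2) f : Lp H 2 P)‖ ^ 2 =
      ‖(condExpL2 H ℝ h2 f : Lp H 2 P)‖ ^ 2 -
        ‖(condExpL2 H ℝ (h12.trans h2) f : Lp H 2 P)‖ ^ 2 := by
  have hm := aestronglyMeasurable_condExpL2 (𝕜 := ℝ) (h12.trans h2) f
  have e1 := inner_condExpL2_eq_inner_fun (𝕜 := ℝ) h2 f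
    (condExpL2 H ℝ (h12.trans h2) f : Lp H 2 P) (hm.mono h12)
  have e2 := inner_condExpL2_eq_inner_fun (𝕜 := ℝ) (h12.trans h2) f
    (condExpL2 H ℝ (h12.trans h2) f : Lp H 2 P) hm
  rw [real_inner_self_eq_norm_sq] at e2
  rw [norm_sub_sq_real, e1, ← e2]
  ring

variable [IsProbabilityMeasure P] [SecondCountableTopology H]

/-- By Pythagoras the squared distance between conditional expectations at two times is the
increment of the monotone function `‖C t‖ ^ 2`. Replacing `t` by the first `q n ≤ t` with increment
at most `ε` keeps the process adapted, and leaves only countably many random variables, selected by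
an index measurable in time. -/
theorem exists_prog_approx (hT : 0 ≤ T) (ℱ : Filtration (Time T) mΩ) {X : Ω → H}
    (hX : MemLp X 2 P) {ε : ℝ} (hε : 0 < ε) :
    ∃ M : Time T → Ω → H, IsStronglyProgressive ℱ M ∧
      ∀ t, ∫⁻ ω, ‖M t ω - (P[X | ℱ t]) ω‖ₑ ^ 2 ∂P ≤ ENNReal.ofReal ε := by
  classical
  set C : Time T → Lp H 2 P := fun t => (condExpL2 H ℝ (ℱ.le t) hX.toLp : Lp H 2 P) with hC
  have hCX : ∀ t, C t =ᵐ[P] P[X | ℱ t] := fun t => hX.condExpL2_ae_eq_condExp (ℱ.le t)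
  have hsub : ∀ s t, s ≤ t → ‖C t - C s‖ ^ 2 = ‖C t‖ ^ 2 - ‖C s‖ ^ 2 := fun s t hst =>
    norm_condExpL2_sub_sq (ℱ.mono hst) (ℱ.le t) hX.toLp
  have hmono : Monotone fun t => ‖C t‖ ^ 2 := fun s t hst => by
    have := hsub s t hst
    have h2 := sq_nonneg ‖C t - C s‖
    simp only
    linarith
  obtain ⟨q, hq⟩ := exists_seq_left_approx hT hmono hε
  refine ⟨fun t => P[X | ℱ (q (Nat.find (hq t)))], fun i => ?_, fun t => ?_⟩
  · borelize H
    let _ : MeasurableSpace Ω := ℱ i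
    -- Candidates with `q n > i` need not be `ℱ i`-measurable; they are set to zero, since no time
    -- up to `i` selects them.
    have hm : ∀ n, Measurable fun p : Set.Iic i × Ω =>
        if q n ≤ i then (P[X | ℱ (q n)]) p.2 else 0 := by
      intro n
      split_ifs with h
      · have h1 : StronglyMeasurable[ℱ i] (P[X | ℱ (q n)]) :=
          stronglyMeasurable_condExp.mono (ℱ.mono h)
        exact h1.measurable.comp measurable_snd
      · exact measurable_const
    have h2 := Measurable.find hm (p := fun n p => q n ≤ (p.1 : Time T) ∧
        ‖C (p.1 : Time T)‖ ^ 2 ≤ ‖C (q n)‖ ^ 2 + ε) (fun n => ?_) (fun p => hq p.1)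
    · refine Measurable.stronglyMeasurable ?_
      have e : (fun p : Set.Iic i × Ω => (P[X | ℱ (q (Nat.find (hq p.1)))]) p.2) = fun p =>
          if q (Nat.find (hq p.1)) ≤ i then (P[X | ℱ (q (Nat.find (hq p.1)))]) p.2 else 0 :=
        funext fun p => (if_pos ((Nat.find_spec (hq p.1)).1.trans p.1.2)).symm
      exact e ▸ h2
    · have hc : Measurable fun p : Set.Iic i × Ω => (p.1 : Time T) :=
        measurable_subtype_coe.comp measurable_fst
      exact (measurableSet_le measurable_const hc).inter
        (measurableSet_le (hmono.measurable.comp hc) measurable_const)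
  · set s := q (Nat.find (hq t))
    obtain ⟨h1, h2⟩ := Nat.find_spec (hq t)
    have h3 : ‖C t - C s‖ ^ 2 ≤ ε := by
      rw [hsub s t h1]
      linarith
    have h4 : ∫⁻ ω, ‖(P[X | ℱ s]) ω - (P[X | ℱ t]) ω‖ₑ ^ 2 ∂P = ‖C t - C s‖ₑ ^ 2 := by
      have h5 := eLpNorm_nnreal_pow_eq_lintegral (f := (C t - C s : Lp H 2 P)) (μ := P) (p := 2)
        two_ne_zero
      rw [Lp.enorm_def]
      have h6 : eLpNorm (C t - C s : Lp H 2 P) 2 P ^ 2 =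
          ∫⁻ ω, ‖(C t - C s : Lp H 2 P) ω‖ₑ ^ 2 ∂P := by simpa using h5
      rw [h6]
      refine lintegral_congr_ae ?_
      filter_upwards [hCX t, hCX s, Lp.coeFn_sub (C t) (C s)] with ω e1 e2 e3
      rw [e3, Pi.sub_apply, e1, e2, ← enorm_neg, neg_sub]
    rw [h4, ← ofReal_norm, ← ENNReal.ofReal_pow (norm_nonneg _)]
    exact ENNReal.ofReal_le_ofReal h3

/-- The squared errors `(1 / 2) ^ k` are summable, so at each fixed `t` the approximations converge
almost surely; `limUnder` preserves progressive measurability. -/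
theorem exists_prog_condExp (hT : 0 ≤ T) (ℱ : Filtration (Time T) mΩ) {X : Ω → H}
    (hX : MemLp X 2 P) :
    ∃ M : Time T → Ω → H, IsStronglyProgressive ℱ M ∧ ∀ t, M t =ᵐ[P] P[X | ℱ t] := by
  choose M hM hMX using fun k : ℕ => exists_prog_approx hT ℱ hX
    (show (0 : ℝ) < (1 / 2) ^ k by positivity)
  refine ⟨fun t ω => limUnder atTop fun k => M k t ω, fun i => ?_, fun t => ?_⟩
  · let _ : MeasurableSpace (Set.Iic i × Ω) := Subtype.instMeasurableSpace.prod (ℱ i)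
    exact StronglyMeasurable.limUnder fun k => hM k i
  · have hadapt : ∀ k, StronglyMeasurable (M k t) := fun k =>
      ((hM k).stronglyAdapted t).mono (ℱ.le t)
    have hcond : StronglyMeasurable (P[X | ℱ t]) := stronglyMeasurable_condExp.mono (ℱ.le t)
    have hmeas : ∀ k, Measurable fun ω => ‖M k t ω - (P[X | ℱ t]) ω‖ₑ ^ 2 := fun k =>
      (((hadapt k).sub hcond).enorm).pow_const 2
    have hsum : ∫⁻ ω, ∑' k, ‖M k t ω - (P[X | ℱ t]) ω‖ₑ ^ 2 ∂P ≠ ∞ := by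
      rw [lintegral_tsum fun k => (hmeas k).aemeasurable]
      refine ((ENNReal.tsum_le_tsum fun k => hMX k t).trans_lt ?_).ne
      rw [← ENNReal.ofReal_tsum_of_nonneg (fun k => by positivity)
        (summable_geometric_of_lt_one (by norm_num) (by norm_num))]
      exact ENNReal.ofReal_lt_top
    filter_upwards [ae_lt_top (Measurable.tsum hmeas) hsum] with ω hω
    have h0 := ENNReal.tendsto_atTop_zero_of_tsum_ne_top hω.ne
    have h1 : Tendsto (fun k => ‖M k t ω - (P[X | ℱ t]) ω‖ ^ 2) atTop (nhds 0) := by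
      have := (ENNReal.tendsto_toReal ENNReal.zero_ne_top).comp h0
      refine this.congr fun k => ?_
      simp [← ofReal_norm, ENNReal.toReal_pow]
    have h2 : Tendsto (fun k => ‖M k t ω - (P[X | ℱ t]) ω‖) atTop (nhds 0) := by
      simpa [Real.sqrt_sq] using h1.sqrt
    exact (tendsto_iff_norm_sub_tendsto_zero.2 h2).limUnder_eq

end CondExp

/-! ### Progressively measurable transforms -/

section Transforms

variable {Ω : Type*} [mΩ : MeasurableSpace Ω] {P : Measure Ω} {ℱ : Filtration (Time T) mΩ}

theorem prog_inner {h : Time T → L2 T} (hh : StronglyMeasurable h) {M : Time T → Ω → L2 T}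
    (hM : IsStronglyProgressive ℱ M) :
    IsStronglyProgressive ℱ fun t ω => inner ℝ (h t) (M t ω) := by
  intro i
  let _ : MeasurableSpace (Set.Iic i × Ω) := Subtype.instMeasurableSpace.prod (ℱ i)
  have h1 : Measurable fun p : Set.Iic i × Ω => (p.1 : Time T) :=
    measurable_subtype_coe.comp (@measurable_fst _ _ _ (ℱ i))
  exact (hh.comp_measurable h1).inner (hM i)

/-- For `t ≤ i` the kernel vanishes at `s > i`, so `u` may be cut off at `i`, and the cut-off
process is jointly measurable with respect to `ℱ i`. -/
theorem prog_kernelApply {B : Kernel2 T} (hB : Measurable (Function.uncurry B))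
    (hV : IsVolterra B) {u : Time T → Ω → ℝ} (hu : IsStronglyProgressive ℱ u) :
    IsStronglyProgressive ℱ fun t ω => kernelApply B (fun s => u s ω) t := by
  intro i
  have hu' := isStronglyProgressive_iff.1 hu i
  let _ : MeasurableSpace Ω := ℱ i
  have h1 : Measurable fun p : (Set.Iic i × Ω) × Time T =>
      B p.1.1 p.2 * if p.2 ≤ i then u p.2 p.1.2 else 0 := by
    refine Measurable.mul ?_ ?_
    · exact hB.comp ((measurable_subtype_coe.comp (measurable_fst.comp measurable_fst)).prodMk
        measurable_snd)
    · exact hu'.comp (measurable_snd.prodMk (measurable_snd.comp measurable_fst))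
  have h2 := (h1.stronglyMeasurable).integral_prod_right' (ν := leb T)
  have e : (fun p : Set.Iic i × Ω => kernelApply B (fun s => u s p.2) p.1) = fun p =>
      ∫ s, B p.1 s * (if s ≤ i then u s p.2 else 0) ∂(leb T) := by
    funext p
    refine integral_congr_ae (ae_of_all _ fun s => ?_)
    by_cases h : s ≤ i
    · simp [h]
    · simp [h, hV p.1 s (p.1.2.trans (not_le.1 h).le)]
  exact e ▸ h2

theorem lintegral_enorm_condExp_sq_le {m : MeasurableSpace Ω} (X : Ω → L2 T) :
    ∫⁻ ω, ‖(P[X | m]) ω‖ₑ ^ 2 ∂P ≤ ∫⁻ ω, ‖X ω‖ₑ ^ 2 ∂P := by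
  have h1 := eLpNorm_nnreal_pow_eq_lintegral (f := X) (μ := P) (p := 2) two_ne_zero
  have h2 := eLpNorm_nnreal_pow_eq_lintegral (f := P[X | m]) (μ := P) (p := 2) two_ne_zero
  have h3 : eLpNorm X 2 P ^ 2 = ∫⁻ ω, ‖X ω‖ₑ ^ 2 ∂P := by simpa using h1
  have h4 : eLpNorm (P[X | m]) 2 P ^ 2 = ∫⁻ ω, ‖(P[X | m]) ω‖ₑ ^ 2 ∂P := by simpa using h2
  rw [← h3, ← h4]
  gcongr
  exact eLpNorm_condExp_le_eLpNorm X one_le_two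

/-- Conditional expectation contracts the `L²` norm, so the second moment is at most `C² 𝔼‖X‖²`,
uniformly in `t`. -/
theorem admissible_inner_condExp {h : Time T → L2 T} (hh : StronglyMeasurable h)
    {C : ℝ} (hC : ∀ t, ‖h t‖ ≤ C) {X : Ω → L2 T} (hX : MemLp X 2 P) {M : Time T → Ω → L2 T}
    (hM : IsStronglyProgressive ℱ M) (hMX : ∀ t, M t =ᵐ[P] P[X | ℱ t]) :
    AdmissibleProcess P ℱ fun t ω => inner ℝ (h t) (M t ω) := by
  refine ⟨prog_inner hh hM, ?_⟩
  have h1 : ∀ t, ∫⁻ ω, ENNReal.ofReal (inner ℝ (h t) (M t ω) ^ 2) ∂P ≤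
      ENNReal.ofReal C ^ 2 * ∫⁻ ω, ‖X ω‖ₑ ^ 2 ∂P := by
    intro t
    refine le_trans ?_ (mul_le_mul_right (lintegral_enorm_condExp_sq_le (m := ℱ t) X) _)
    rw [← lintegral_const_mul' _ _ (by simp)]
    refine lintegral_mono_ae ?_
    filter_upwards [hMX t] with ω hω
    rw [hω, ← enorm_sq_eq_ofReal_sq, ← mul_pow, ← ofReal_norm, ← ofReal_norm,
      ← ENNReal.ofReal_mul ((norm_nonneg _).trans (hC t))]
    gcongr
    exact (norm_inner_le_norm _ _).trans (mul_le_mul_of_nonneg_right (hC t) (norm_nonneg _))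
  refine (lintegral_mono h1).trans_lt ?_
  rw [lintegral_const]
  refine ENNReal.mul_lt_top (ENNReal.mul_lt_top (by simp) ?_) (measure_lt_top _ _)
  exact (memLp_two_iff_lintegral_enorm_sq hX.1).1 hX

namespace AdmissibleProcess

variable [IsProbabilityMeasure P]

theorem kernelApply_coe (hT : 0 ≤ T) {B : Kernel2 T} (hB : SqIntegrableKernel B)
    {u : Time T → Ω → ℝ} (hu : AdmissibleProcess P ℱ u) :
    ∀ᵐ ω ∂P, intOp B (path u ω) =ᵐ[leb T] fun t => kernelApply B (fun s => u s ω) t := by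
  filter_upwards [hu.ae_memLp hT] with ω hω
  exact intOp_apply_toL2 hB hω

theorem kernelApply (hT : 0 ≤ T) {B : Kernel2 T} (hm : Measurable (Function.uncurry B))
    (hV : IsVolterra B) (hB : SqIntegrableKernel B) {u : Time T → Ω → ℝ}
    (hu : AdmissibleProcess P ℱ u) :
    AdmissibleProcess P ℱ fun t ω => kernelApply B (fun s => u s ω) t :=
  of_path hT (prog_kernelApply hm hV hu.prog) ((intOp B).comp_memLp' (hu.memLp_path hT))
    (hu.kernelApply_coe hT hB)

end AdmissibleProcess

end Transforms

/-! ### The coefficient `ā` -/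

section Coefficient

variable {Ω : Type*} [mΩ : MeasurableSpace Ω] {P : Measure Ω}
  {ℱ : Filtration (Time T) mΩ} {N : ℕ} {A1 A2hat A3 : Kernel2 T} {lam : ℝ}
  {b0 : Time T → Ω → ℝ} {b : Fin N → Time T → Ω → ℝ}

theorem abarAt_eq (hN : 1 ≤ N) (h1 : GoodKernel A1) (h2 : GoodKernel A2hat) (h3 : GoodKernel A3)
    (hlam : 0 < lam) (t : Time T) (ω : Ω) :
    abarAt P ℱ lam A1 A2hat A3 b0 b t ω = 1 / (2 * lam) * (drift b0 b t ω -
      inner ℝ (gainVec lam (kerKbar N A1 A2hat A3) t) (condPath P ℱ (drift b0 b) t ω)) := by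
  rw [abarAt, opDbar_eq h1 h2 h3, ← projFrom_apply,
    (good_kerKbar hN h1 h2 h3).inner_inverse_projFrom hlam]
  rfl

variable [IsProbabilityMeasure P]

theorem admissible_drift (hT : 0 ≤ T) (hb0 : AdmissibleProcess P ℱ b0)
    (hb : ∀ i, AdmissibleProcess P ℱ (b i)) : AdmissibleProcess P ℱ (drift b0 b) :=
  (AdmissibleProcess.avg hT hb).add hT (hb0.const_mul hT _)

theorem exists_abar (hT : 0 ≤ T) (hN : 1 ≤ N) (h1 : GoodKernel A1) (h2 : GoodKernel A2hat)
    (h3 : GoodKernel A3) (hlam : 0 < lam) (hb0 : AdmissibleProcess P ℱ b0)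
    (hb : ∀ i, AdmissibleProcess P ℱ (b i)) :
    ∃ a : Time T → Ω → ℝ, AdmissibleProcess P ℱ a ∧
      ∀ t, a t =ᵐ[P] abarAt P ℱ lam A1 A2hat A3 b0 b t := by
  have hK := good_kerKbar hN h1 h2 h3
  have hd := admissible_drift hT hb0 hb
  obtain ⟨M, hM, hMX⟩ := exists_prog_condExp hT ℱ (hd.memLp_path hT)
  obtain ⟨C, -, hC⟩ := hK.exists_gainVec_bound hlam
  refine ⟨fun t ω => 1 / (2 * lam) * (drift b0 b t ω -
    inner ℝ (gainVec lam (kerKbar N A1 A2hat A3) t) (M t ω)),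
    (hd.sub hT (admissible_inner_condExp (hK.stronglyMeasurable_gainVec hlam) hC
      (hd.memLp_path hT) hM hMX)).const_mul hT _, fun t => ?_⟩
  filter_upwards [hMX t] with ω hω
  rw [abarAt_eq hN h1 h2 h3 hlam, hω, condPath]

end Coefficient

/-! ### First-order conditions -/

theorem eq_zero_of_forall_quadratic_nonpos {L Q : ℝ} (h : ∀ ε : ℝ, ε * L + ε ^ 2 * Q ≤ 0) :
    L = 0 := by
  by_contra hL
  -- This `ε` makes the expression `ε² (|Q| + 1 + Q)`, which is positive whatever the sign of `Q`.
  have h1 := h (L / (|Q| + 1))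
  have hq : 0 < |Q| + 1 := by positivity
  have h2 : L / (|Q| + 1) * L + (L / (|Q| + 1)) ^ 2 * Q =
      (L / (|Q| + 1)) ^ 2 * (|Q| + 1 + Q) := by
    field_simp
  rw [h2] at h1
  have h3 : 0 < |Q| + 1 + Q := by linarith [neg_abs_le Q]
  have h4 : 0 < (L / (|Q| + 1)) ^ 2 := by positivity
  exact absurd h1 (not_le.2 (mul_pos h4 h3))

/-! ### The quadratic reward on an abstract Hilbert space. -/

section Hilbert

variable {E : Type*} [NormedAddCommGroup E] [InnerProductSpace ℝ E]

/-- The random reward of a player as a function of own strategy `x` and mean strategy `y`. -/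
def reward (A B S : E →L[ℝ] E) (b b0 x y : E) : ℝ :=
  - inner ℝ y (A y) - inner ℝ x (B x) - inner ℝ x (S y) + inner ℝ b x + inner ℝ b0 y

/-- The derivative of `reward` in the direction `(w, ν w)`. -/
def rewardDeriv (A B S : E →L[ℝ] E) (ν : ℝ) (b b0 x y w : E) : ℝ :=
  - (ν * (inner ℝ y (A w) + inner ℝ w (A y))) - (inner ℝ x (B w) + inner ℝ w (B x))
    - (inner ℝ w (S y) + ν * inner ℝ x (S w)) + inner ℝ b w + ν * inner ℝ b0 w

theorem reward_add_smul (A B S : E →L[ℝ] E) (ν ε : ℝ) (b b0 x y w : E) :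
    reward A B S b b0 (x + ε • w) (y + (ε * ν) • w) =
      reward A B S b b0 x y + (ε * rewardDeriv A B S ν b b0 x y w
        + ε ^ 2 * -(ν ^ 2 * inner ℝ w (A w) + inner ℝ w (B w) + ν * inner ℝ w (S w))) := by
  simp only [reward, rewardDeriv, map_add, map_smul, inner_add_left, inner_add_right,
    real_inner_smul_left, real_inner_smul_right]
  ring

/-- For fixed `y` and `w` the derivative is affine in the pair `(b i, x i)`, so averaging replaces
`x i` by the mean `y` and the system closes. -/
theorem sum_rewardDeriv (A B S : E →L[ℝ] E) {N : ℕ} (hN : 1 ≤ N) (b x : Fin N → E)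
    (b0 y w : E) (hy : y = (1 / (N : ℝ)) • ∑ i, x i) :
    (1 / (N : ℝ)) * ∑ i, rewardDeriv A B S (1 / (N : ℝ)) (b i) b0 (x i) y w =
      - ((1 / (N : ℝ)) * (inner ℝ y (A w) + inner ℝ w (A y))) - (inner ℝ y (B w) + inner ℝ w (B y))
      - (inner ℝ w (S y) + (1 / (N : ℝ)) * inner ℝ y (S w))
      + inner ℝ ((1 / (N : ℝ)) • ∑ i, b i + (1 / (N : ℝ)) • b0) w := by
  have hN' : (N : ℝ) ≠ 0 := by positivity
  simp only [rewardDeriv, Finset.sum_add_distrib, Finset.sum_sub_distrib, Finset.sum_neg_distrib,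
    Finset.sum_const, Finset.card_univ, Fintype.card_fin, nsmul_eq_mul, ← Finset.mul_sum,
    ← sum_inner, ← inner_sum, ← map_sum]
  have hx : ∑ i, x i = (N : ℝ) • y := by
    rw [hy, smul_smul, mul_one_div_cancel hN', one_smul]
  rw [hx]
  simp only [map_smul, inner_add_left, real_inner_smul_left, real_inner_smul_right]
  field_simp
  ring

end Hilbert

theorem integrable_inner {Ω E : Type*} [MeasurableSpace Ω] {P : Measure Ω} [NormedAddCommGroup E]
    [InnerProductSpace ℝ E] {f g : Ω → E} (hf : MemLp f 2 P) (hg : MemLp g 2 P) :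
    Integrable (fun ω => inner ℝ (f ω) (g ω)) P :=
  (hf.norm.integrable_mul hg.norm).mono' (hf.1.inner hg.1)
    (ae_of_all _ fun _ => norm_inner_le_norm _ _)

theorem integrable_rewardDeriv {Ω E : Type*} [MeasurableSpace Ω] {P : Measure Ω}
    [NormedAddCommGroup E] [InnerProductSpace ℝ E] (A B S : E →L[ℝ] E) (ν : ℝ)
    {b b0 x y w : Ω → E} (hb : MemLp b 2 P) (hb0 : MemLp b0 2 P) (hx : MemLp x 2 P)
    (hy : MemLp y 2 P) (hw : MemLp w 2 P) :
    Integrable (fun ω => rewardDeriv A B S ν (b ω) (b0 ω) (x ω) (y ω) (w ω)) P := by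
  have op : ∀ (C : E →L[ℝ] E) {f : Ω → E}, MemLp f 2 P → MemLp (fun ω => C (f ω)) 2 P :=
    fun C f hf => C.comp_memLp' hf
  exact ((((((integrable_inner hy (op A hw)).add (integrable_inner hw (op A hy))).const_mul ν).neg.sub
    ((integrable_inner hx (op B hw)).add (integrable_inner hw (op B hx)))).sub
    ((integrable_inner hw (op S hy)).add ((integrable_inner hx (op S hw)).const_mul ν))).add
    (integrable_inner hb hw)).add ((integrable_inner hb0 hw).const_mul ν)

theorem avg_update {Ω : Type*} {N : ℕ} (u : Fin N → Time T → Ω → ℝ) (i : Fin N)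
    (v : Time T → Ω → ℝ) (ε : ℝ) :
    avg (Function.update u i fun t ω => u i t ω + ε * v t ω) =
      fun t ω => avg u t ω + (ε * (1 / (N : ℝ))) * v t ω := by
  funext t ω
  have h : ∀ j, Function.update u i (fun t ω => u i t ω + ε * v t ω) j t ω =
      u j t ω + if j = i then ε * v t ω else 0 := by
    intro j
    by_cases hj : j = i
    · subst hj
      simp
    · simp [hj]
  simp only [avg, h, Finset.sum_add_distrib, Finset.sum_ite_eq', Finset.mem_univ, if_true]
  ring

/-! ### The averaged first-order condition at an equilibrium. -/

section Game

variable {Ω : Type*} [mΩ : MeasurableSpace Ω] {P : Measure Ω} [IsProbabilityMeasure P]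
  {ℱ : Filtration (Time T) mΩ} {N : ℕ} {A1 A2hat A3 : Kernel2 T} {lam : ℝ}
  {b0 : Time T → Ω → ℝ} {b : Fin N → Time T → Ω → ℝ} {c : Fin N → Ω → ℝ}
  {u : Fin N → Time T → Ω → ℝ}

/-- A deviation of player `i` by `ε v` moves the mean by `(ε / N) v`; the gain is `ε L + ε² Q`,
nonpositive for every real `ε`, so `L = 0`. -/
theorem IsNashEquilibrium.integral_rewardDeriv_eq_zero (hT : 0 ≤ T)
    (hb0 : AdmissibleProcess P ℱ b0) (hb : ∀ i, AdmissibleProcess P ℱ (b i))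
    (hc : ∀ i, Integrable (c i) P) (hu : IsNashEquilibrium P ℱ lam A1 A2hat A3 b0 b c u)
    {v : Time T → Ω → ℝ} (hv : AdmissibleProcess P ℱ v) (i : Fin N) :
    ∫ ω, rewardDeriv (intOp A1) (opA2 lam A2hat) (intOp A3 + intOp (adjKernel A3)) (1 / (N : ℝ))
      (path (b i) ω) (path b0 ω) (path (u i) ω) (path (avg u) ω) (path v ω) ∂P = 0 := by
  set A := intOp A1
  set B := opA2 lam A2hat
  set S := intOp A3 + intOp (adjKernel A3)
  set ν : ℝ := 1 / (N : ℝ)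
  have hx := (hu.admissible i).memLp_path hT
  have hya := AdmissibleProcess.avg hT hu.admissible
  have hy := hya.memLp_path hT
  have hw := hv.memLp_path hT
  have hbi := (hb i).memLp_path hT
  have hb0' := hb0.memLp_path hT
  have op : ∀ (C : L2 T →L[ℝ] L2 T) {f : Ω → L2 T}, MemLp f 2 P → MemLp (fun ω => C (f ω)) 2 P :=
    fun C f hf => C.comp_memLp' hf
  set R : Ω → ℝ := fun ω => reward A B S (path (b i) ω) (path b0 ω) (path (u i) ω)
    (path (avg u) ω) + c i ω with hR
  set L : Ω → ℝ := fun ω => rewardDeriv A B S ν (path (b i) ω) (path b0 ω) (path (u i) ω)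
    (path (avg u) ω) (path v ω) with hL
  set Q : Ω → ℝ := fun ω => -(ν ^ 2 * inner ℝ (path v ω) (A (path v ω)) +
    inner ℝ (path v ω) (B (path v ω)) + ν * inner ℝ (path v ω) (S (path v ω))) with hQ
  have hRi : Integrable R P :=
    (((((integrable_inner hy (op A hy)).neg.sub (integrable_inner hx (op B hx))).sub
      (integrable_inner hx (op S hy))).add (integrable_inner hbi hx)).add
      (integrable_inner hb0' hy)).add (hc i)
  have hLi : Integrable L P := integrable_rewardDeriv A B S ν hbi hb0' hx hy hw
  have hQi : Integrable Q P :=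
    ((((integrable_inner hw (op A hw)).const_mul (ν ^ 2)).add (integrable_inner hw (op B hw))).add
      ((integrable_inner hw (op S hw)).const_mul ν)).neg
  refine eq_zero_of_forall_quadratic_nonpos (Q := ∫ ω, Q ω ∂P) fun ε => ?_
  have hopt := hu.optimal i (fun t ω => u i t ω + ε * v t ω)
    ((hu.admissible i).add hT (hv.const_mul hT ε))
  have e0 : performance P lam A1 A2hat A3 b0 b c i u = ∫ ω, R ω ∂P := rfl
  have e1 : performance P lam A1 A2hat A3 b0 b c i
      (Function.update u i fun t ω => u i t ω + ε * v t ω) =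
      ∫ ω, (R ω + (ε * L ω + ε ^ 2 * Q ω)) ∂P := by
    refine integral_congr_ae ?_
    filter_upwards [(hu.admissible i).path_add hT (hv.const_mul hT ε), hv.path_const_mul hT ε,
      hya.path_add hT (hv.const_mul hT (ε * ν)), hv.path_const_mul hT (ε * ν)] with ω h1 h2 h3 h4
    rw [Pi.add_apply, h2, Pi.smul_apply] at h1
    rw [Pi.add_apply, h4, Pi.smul_apply] at h3
    rw [avg_update, Function.update_self, h1, h3]
    have := reward_add_smul A B S ν ε (path (b i) ω) (path b0 ω) (path (u i) ω)
      (path (avg u) ω) (path v ω)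
    rw [hR, hL, hQ]
    simp only [reward] at this ⊢
    linarith
  have hLQ : Integrable (fun ω => ε * L ω + ε ^ 2 * Q ω) P :=
    (hLi.const_mul ε).add (hQi.const_mul (ε ^ 2))
  rw [e0, e1, integral_add hRi hLQ, integral_add (hLi.const_mul ε) (hQi.const_mul (ε ^ 2)),
    integral_const_mul, integral_const_mul] at hopt
  linarith

theorem path_drift (hT : 0 ≤ T) (hb0 : AdmissibleProcess P ℱ b0)
    (hb : ∀ i, AdmissibleProcess P ℱ (b i)) :
    path (drift b0 b) =ᵐ[P] fun ω =>
      (1 / (N : ℝ)) • ∑ i, path (b i) ω + (1 / (N : ℝ)) • path b0 ω := by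
  filter_upwards [(AdmissibleProcess.avg hT hb).path_add hT (hb0.const_mul hT (1 / (N : ℝ))),
    AdmissibleProcess.path_avg hT hb, hb0.path_const_mul hT (1 / (N : ℝ))] with ω h1 h2 h3
  rw [Pi.add_apply, h2, h3] at h1
  exact h1

/-- The residual of the averaged first-order condition. -/
def residual (lam : ℝ) (K : Kernel2 T) (y d : L2 T) : L2 T :=
  (2 * lam) • y + intOp K y + intOp (adjKernel K) y - d

/-- `A₁` enters through the mean with weight `1/N`, `Â₂` through the own strategy with weight `1`,
and `A₃` through both, each symmetrised. These weights assemble `K̄ + K̄*`. -/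
theorem mean_rewardDeriv_eq (hN : 1 ≤ N) (h1 : GoodKernel A1) (h2 : GoodKernel A2hat)
    (h3 : GoodKernel A3) (lam : ℝ) (b x : Fin N → L2 T) (b0 y w : L2 T)
    (hy : y = (1 / (N : ℝ)) • ∑ i, x i) :
    (1 / (N : ℝ)) * ∑ i, rewardDeriv (intOp A1) (opA2 lam A2hat)
      (intOp A3 + intOp (adjKernel A3)) (1 / (N : ℝ)) (b i) b0 (x i) y w =
      - inner ℝ w (residual lam (kerKbar N A1 A2hat A3) y
        ((1 / (N : ℝ)) • ∑ i, b i + (1 / (N : ℝ)) • b0)) := by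
  rw [sum_rewardDeriv _ _ _ hN b x b0 y w hy]
  generalize ∑ i, b i = β
  have q1 := h1.sqIntegrable
  have q2 := h2.sqIntegrable
  have q3 := h3.sqIntegrable
  have e1 : intOp (kerKbar N A1 A2hat A3) = (1 / (N : ℝ)) • intOp A1 +
      ((1 + 1 / (N : ℝ)) • intOp A3 + intOp A2hat) := by
    rw [kerKbar_eq hN, intOp_add (q1.const_mul _) ((q3.const_mul _).add q2),
      intOp_add (q3.const_mul _) q2, intOp_const_mul _ q1, intOp_const_mul _ q3]
  have q := (good_kerKbar hN h1 h2 h3).sqIntegrable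
  simp only [residual, inner_sub_right, inner_add_right, inner_intOp_adj q, e1, opA2, add_apply,
    smul_apply, ContinuousLinearMap.id_apply, real_inner_smul_left, real_inner_smul_right,
    inner_add_left, inner_intOp_adj q3]
  rw [real_inner_comm (intOp A1 w) y, real_inner_comm (intOp A2hat w) y,
    real_inner_comm (intOp A3 w) y, real_inner_comm w y, real_inner_comm w (intOp A3 y),
    real_inner_comm w β, real_inner_comm w b0]
  ring

theorem IsNashEquilibrium.integral_inner_residual (hT : 0 ≤ T) (hN : 1 ≤ N)
    (h1 : GoodKernel A1) (h2 : GoodKernel A2hat) (h3 : GoodKernel A3)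
    (hb0 : AdmissibleProcess P ℱ b0) (hb : ∀ i, AdmissibleProcess P ℱ (b i))
    (hc : ∀ i, Integrable (c i) P) (hu : IsNashEquilibrium P ℱ lam A1 A2hat A3 b0 b c u)
    {v : Time T → Ω → ℝ} (hv : AdmissibleProcess P ℱ v) :
    ∫ ω, inner ℝ (path v ω) (residual lam (kerKbar N A1 A2hat A3) (path (avg u) ω)
      (path (drift b0 b) ω)) ∂P = 0 := by
  have hi := fun i => hu.integral_rewardDeriv_eq_zero hT hb0 hb hc hv i
  have hint := fun i => integrable_rewardDeriv (intOp A1) (opA2 lam A2hat)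
    (intOp A3 + intOp (adjKernel A3)) (1 / (N : ℝ)) ((hb i).memLp_path hT) (hb0.memLp_path hT)
    ((hu.admissible i).memLp_path hT) ((AdmissibleProcess.avg hT hu.admissible).memLp_path hT)
    (hv.memLp_path hT)
  have hsum : ∫ ω, (1 / (N : ℝ)) * ∑ i, rewardDeriv (intOp A1) (opA2 lam A2hat)
      (intOp A3 + intOp (adjKernel A3)) (1 / (N : ℝ)) (path (b i) ω) (path b0 ω) (path (u i) ω)
      (path (avg u) ω) (path v ω) ∂P = 0 := by
    rw [integral_const_mul, integral_finsetSum _ fun i _ => hint i]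
    simp only [hi, Finset.sum_const_zero, mul_zero]
  rw [← neg_eq_zero, ← integral_neg]
  refine Eq.trans (integral_congr_ae ?_) hsum
  filter_upwards [AdmissibleProcess.path_avg hT hu.admissible, path_drift hT hb0 hb]
    with ω e1 e2
  rw [e2, ← mean_rewardDeriv_eq hN h1 h2 h3 lam (fun i => path (b i) ω) (fun i => path (u i) ω)
    (path b0 ω) (path (avg u) ω) (path v ω) e1]

end Game

/-! ### Conditioning the averaged first-order condition on `ℱ_t`. -/

section Adapted

variable {Ω : Type*} [mΩ : MeasurableSpace Ω] {P : Measure Ω} [IsProbabilityMeasure P]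
  {ℱ : Filtration (Time T) mΩ}

theorem memLp_two_prod {f : Time T → Ω → ℝ} (hf : Measurable (Function.uncurry f))
    (h : ∫⁻ s, ∫⁻ ω, ENNReal.ofReal (f s ω ^ 2) ∂P ∂(leb T) < ∞) :
    MemLp (Function.uncurry f) 2 ((leb T).prod P) := by
  rw [memLp_two_iff_lintegral_sq hf.aestronglyMeasurable,
    lintegral_prod _ (hf.pow_const 2).ennreal_ofReal.aemeasurable]
  exact h

theorem ae_memLp_section {f : Time T → Ω → ℝ} (hf : Measurable (Function.uncurry f))
    (h : ∫⁻ s, ∫⁻ ω, ENNReal.ofReal (f s ω ^ 2) ∂P ∂(leb T) < ∞) :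
    ∀ᵐ t ∂(leb T), MemLp (f t) 2 P := by
  have hm : Measurable fun p : Time T × Ω => ENNReal.ofReal (f p.1 p.2 ^ 2) :=
    (hf.pow_const 2).ennreal_ofReal
  filter_upwards [ae_lt_top (Measurable.lintegral_prod_right' hm) h.ne] with t ht
  exact (memLp_two_iff_lintegral_sq
    (hf.comp (measurable_const.prodMk measurable_id)).aestronglyMeasurable).2 ht

theorem integral_inner_path {f g : Time T → Ω → ℝ} (hf : Measurable (Function.uncurry f))
    (hf2 : ∫⁻ s, ∫⁻ ω, ENNReal.ofReal (f s ω ^ 2) ∂P ∂(leb T) < ∞)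
    (hg : Measurable (Function.uncurry g))
    (hg2 : ∫⁻ s, ∫⁻ ω, ENNReal.ofReal (g s ω ^ 2) ∂P ∂(leb T) < ∞) :
    ∫ ω, inner ℝ (path f ω) (path g ω) ∂P = ∫ t, ∫ ω, f t ω * g t ω ∂P ∂(leb T) := by
  have hint : Integrable (fun p : Time T × Ω => f p.1 p.2 * g p.1 p.2) ((leb T).prod P) :=
    (memLp_two_prod hf hf2).integrable_mul (memLp_two_prod hg hg2)
  rw [integral_integral_swap hint]
  refine integral_congr_ae ?_
  filter_upwards [ae_memLp_path hf hf2, ae_memLp_path hg hg2] with ω h1 h2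
  exact inner_toL2 h1 h2

/-- Elementary test strategies: `1_A(ω) 1_{t ≤ s} f(s)` with `A ∈ ℱ_t`. -/
theorem admissible_indicator_mul (hT : 0 ≤ T) {t : Time T} {A : Set Ω}
    (hA : MeasurableSet[ℱ t] A) (f : L2 T) :
    AdmissibleProcess P ℱ (fun s ω => A.indicator (fun _ => (1 : ℝ)) ω * if t ≤ s then f s else 0) ∧
      ∀ ω, path (fun s ω => A.indicator (fun _ => (1 : ℝ)) ω * if t ≤ s then f s else 0) ω =
        A.indicator (fun _ => (1 : ℝ)) ω • projFrom t f := by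
  have hpath : ∀ ω, path (fun s ω => A.indicator (fun _ => (1 : ℝ)) ω *
      if t ≤ s then f s else 0) ω = A.indicator (fun _ => (1 : ℝ)) ω • projFrom t f := fun ω =>
    toL2_const_mul _ (memLp_ite_le t (Lp.memLp f))
  have hmeas : StronglyMeasurable fun ω => A.indicator (fun _ => (1 : ℝ)) ω • projFrom t f :=
    (stronglyMeasurable_const.indicator (ℱ.le t _ hA)).smul_const _
  refine ⟨AdmissibleProcess.of_path hT ?_ (ψ := fun ω =>
    A.indicator (fun _ => (1 : ℝ)) ω • projFrom t f) ?_ (ae_of_all _ fun ω => ?_), hpath⟩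
  · refine isStronglyProgressive_iff.2 fun i => ?_
    by_cases h : t ≤ i
    · have hA' := ℱ.mono h _ hA
      let _ : MeasurableSpace Ω := ℱ i
      refine Measurable.ite (measurable_fst measurableSet_Iic) (Measurable.mul ?_ ?_)
        measurable_const
      · exact (measurable_const.indicator hA').comp measurable_snd
      · exact (measurable_ite_le (Lp.stronglyMeasurable f).measurable t).comp measurable_fst
    · have e : (fun p : Time T × Ω => if p.1 ≤ i then A.indicator (fun _ => (1 : ℝ)) p.2 *
          (if t ≤ p.1 then f p.1 else 0) else 0) = fun _ => 0 := by
        funext p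
        by_cases h1 : p.1 ≤ i
        · rw [if_pos h1, if_neg fun h2 => h (h2.trans h1), mul_zero]
        · rw [if_neg h1]
      rw [e]
      exact measurable_const
  · refine MemLp.of_le (memLp_const (projFrom t f)) hmeas.aestronglyMeasurable
      (ae_of_all _ fun ω => ?_)
    rw [norm_smul]
    refine mul_le_of_le_one_left (norm_nonneg _) ?_
    by_cases h : ω ∈ A <;> simp [h]
  · rw [← hpath]
    exact coeFn_toL2 ((memLp_ite_le t (Lp.memLp f)).const_mul _)

/-- If `W` is orthogonal to all strategies, its conditional expectation given `ℱ_t` vanishes on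
`[t,T]`. -/
theorem condExp_projFrom_eq_zero (hT : 0 ≤ T) {W : Ω → L2 T} (hW : MemLp W 2 P)
    (h : ∀ v, AdmissibleProcess P ℱ v → ∫ ω, inner ℝ (path v ω) (W ω) ∂P = 0) (t : Time T) :
    P[fun ω => projFrom t (W ω) | ℱ t] =ᵐ[P] 0 := by
  have hPW : Integrable (fun ω => projFrom t (W ω)) P :=
    ((projFrom t).comp_memLp' hW).integrable one_le_two
  refine (ae_eq_condExp_of_forall_setIntegral_eq (ℱ.le t) hPW
    (fun s _ _ => integrableOn_zero) (fun A hA _ => ?_)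
    stronglyMeasurable_zero.aestronglyMeasurable).symm
  simp only [integral_zero]
  -- The `L²`-valued integral over `A` is tested against each `f`; the pairing is the one of `W`
  -- with the elementary strategy built from `A` and `f`.
  refine ext_inner_left ℝ fun f => ?_
  obtain ⟨hv, hpath⟩ := admissible_indicator_mul (P := P) hT hA f
  rw [inner_zero_right, ← integral_inner hPW.integrableOn, ← integral_indicator (ℱ.le t _ hA)]
  refine (h _ hv).symm.trans ?_
  refine integral_congr_ae (ae_of_all _ fun ω => ?_)
  simp only [hpath]
  by_cases hω : ω ∈ A
  · simp [hω, inner_projFrom]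
  · simp [hω]

/-- Progressivity up to `t` makes `1_{s<t} u_s(ω)` jointly measurable for `ℱ t`; its class in `L²`
is then `ℱ t`-measurable. -/
theorem AdmissibleProcess.aestronglyMeasurable_past (hT : 0 ≤ T) {u : Time T → Ω → ℝ}
    (hu : AdmissibleProcess P ℱ u) (t : Time T) :
    AEStronglyMeasurable[ℱ t] (fun ω => path u ω - projFrom t (path u ω)) P := by
  have hm : StronglyMeasurable[ℱ t] fun ω => toL2 fun s => if s < t then u s ω else 0 := by
    have hu' := isStronglyProgressive_iff.1 hu.prog t
    let _ : MeasurableSpace Ω := ℱ t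
    refine stronglyMeasurable_toL2 (f := fun s ω => if s < t then u s ω else 0) ?_
    have e : (Function.uncurry fun s ω => if s < t then u s ω else 0) = fun p : Time T × Ω =>
        if p.1 < t then (if p.1 ≤ t then u p.1 p.2 else 0) else 0 := by
      funext p
      by_cases h : p.1 < t
      · simp [Function.uncurry, h, h.le]
      · simp [Function.uncurry, h]
    rw [e]
    exact Measurable.ite (measurable_fst measurableSet_Iio) hu' measurable_const
  refine ⟨_, hm, ?_⟩
  filter_upwards [hu.path_coe hT] with ω hω
  rw [← toL2_coe (path u ω - projFrom t (path u ω))]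
  refine toL2_congr ?_
  filter_upwards [coeFn_sub_projFrom t (path u ω), hω] with s h1 h2
  rw [h1, h2]

theorem condExp_clm {W : Ω → L2 T} (hW : MemLp W 2 P) (m : MeasurableSpace Ω)
    (A : L2 T →L[ℝ] L2 T) : P[fun ω => A (W ω) | m] =ᵐ[P] fun ω => A ((P[W | m]) ω) :=
  (A.comp_condExp_comm (hW.integrable one_le_two)).symm

/-- The future of an adapted process solving the averaged first-order condition. -/
theorem condExp_future_eq (hT : 0 ≤ T) {K : Kernel2 T} (hK : GoodKernel K) {lam : ℝ}
    (hlam : 0 < lam) {u : Time T → Ω → ℝ} (hu : AdmissibleProcess P ℱ u) {d : Ω → L2 T}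
    (hd : MemLp d 2 P)
    (h : ∀ v, AdmissibleProcess P ℱ v →
      ∫ ω, inner ℝ (path v ω) (residual lam K (path u ω) (d ω)) ∂P = 0) (t : Time T) :
    ∀ᵐ ω ∂P, projFrom t ((P[path u | ℱ t]) ω) = Ring.inverse (truncSymOp lam K t)
      (projFrom t ((P[d | ℱ t]) ω - intOp K (path u ω - projFrom t (path u ω)))) := by
  have hy := hu.memLp_path hT
  set Φ : L2 T →L[ℝ] L2 T :=
    (2 * lam) • ContinuousLinearMap.id ℝ (L2 T) + intOp K + intOp (adjKernel K) with hΦ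
  have hΦy : MemLp (fun ω => Φ (path u ω)) 2 P := Φ.comp_memLp' hy
  have hW : MemLp (fun ω => residual lam K (path u ω) (d ω)) 2 P := hΦy.sub hd
  have e0 := condExp_projFrom_eq_zero hT hW h t
  have e1 := condExp_clm hW (ℱ t) (projFrom t)
  have e2 : P[fun ω => residual lam K (path u ω) (d ω) | ℱ t] =ᵐ[P]
      P[fun ω => Φ (path u ω) | ℱ t] - P[d | ℱ t] :=
    condExp_sub (hΦy.integrable one_le_two) (hd.integrable one_le_two) (ℱ t)
  have e3 := condExp_clm hy (ℱ t) Φ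
  have e4 := condExp_clm hy (ℱ t) (ContinuousLinearMap.id ℝ (L2 T) - projFrom t)
  have e5 := condExp_of_aestronglyMeasurable' (ℱ.le t) (hu.aestronglyMeasurable_past hT t)
    (((ContinuousLinearMap.id ℝ (L2 T) - projFrom t).comp_memLp' hy).integrable one_le_two)
  filter_upwards [e0, e1, e2, e3, e4, e5] with ω e0 e1 e2 e3 e4 e5
  set m := (P[path u | ℱ t]) ω
  set e := (P[d | ℱ t]) ω
  have p1 : projFrom t (Φ m - e) = 0 := by
    rw [← e3, ← Pi.sub_apply, ← e2, ← e1, e0, Pi.zero_apply]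
  -- The past is its own conditional expectation, so it may be computed from `m = 𝔼_t[u]`.
  have p2 : path u ω - projFrom t (path u ω) = m - projFrom t m := by
    rw [← e5]
    exact e4
  rw [p2]
  -- It remains to verify `D_t P_t m = P_t (e - K (m - P_t m))`, which is `p1` after the two support
  -- identities for `K` and `K*`.
  refine (hK.inverse_truncSymOp hlam t (projFrom t m)).symm.trans ?_
  congr 1
  have p3 := projFrom_intOp_adj_projFrom hK.sqIntegrable hK.volterra t m
  have p4 := projFrom_intOp_projFrom hK.sqIntegrable hK.volterra t m
  simp only [hΦ, map_sub, map_add, map_smul, add_apply, smul_apply,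
    ContinuousLinearMap.id_apply] at p1
  simp only [truncSymOp, add_apply, smul_apply, ContinuousLinearMap.id_apply,
    ContinuousLinearMap.comp_apply, map_sub, projFrom_projFrom, p3, p4]
  rw [sub_eq_zero] at p1
  rw [← p1]
  abel

/-- `K(·,t)` is supported on `[t,T]`, so its pairing with `𝔼_t[u]` involves only the predicted
future already solved for. -/
theorem condExp_inner_col_eq (hT : 0 ≤ T) {K : Kernel2 T} (hK : GoodKernel K) {lam : ℝ}
    (hlam : 0 < lam) {u : Time T → Ω → ℝ} (hu : AdmissibleProcess P ℱ u) {d : Ω → L2 T}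
    (hd : MemLp d 2 P)
    (h : ∀ v, AdmissibleProcess P ℱ v →
      ∫ ω, inner ℝ (path v ω) (residual lam K (path u ω) (d ω)) ∂P = 0) (t : Time T) :
    P[fun ω => inner ℝ (col K t) (path u ω) | ℱ t] =ᵐ[P] fun ω =>
      inner ℝ (gainVec lam K t) ((P[d | ℱ t]) ω) -
        inner ℝ (gainVec lam K t) (intOp K (path u ω - projFrom t (path u ω))) := by
  have e1 := (innerSL ℝ (col K t)).comp_condExp_comm (m := ℱ t)
    ((hu.memLp_path hT).integrable one_le_two)
  filter_upwards [e1, condExp_future_eq hT hK hlam hu hd h t] with ω h1 h2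
  have h3 : (P[fun ω => inner ℝ (col K t) (path u ω) | ℱ t]) ω =
      inner ℝ (col K t) ((P[path u | ℱ t]) ω) := h1.symm
  have h4 := hK.inner_inverse_projFrom hlam t
    ((P[d | ℱ t]) ω - intOp K (path u ω - projFrom t (path u ω)))
  rw [hK.restrictFrom_col, hK.projFrom_col, ← h2, ← inner_projFrom, hK.projFrom_col,
    inner_sub_right] at h4
  rw [h3, h4]

/-! ### The feedback form -/

theorem inner_intOp_eq_integral_col {K : Kernel2 T} (hK : GoodKernel K) (f g : L2 T) :
    inner ℝ f (intOp K g) = ∫ s, inner ℝ f (col K s) * g s ∂(leb T) := by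
  rw [inner_intOp hK.sqIntegrable, integral_integral_swap
    (integrable_inner_kernel hK.sqIntegrable f g)]
  refine integral_congr_ae (ae_of_all _ fun s => ?_)
  simp only
  rw [inner_L2, ← integral_mul_const]
  refine integral_congr_ae ?_
  filter_upwards [coeFn_toL2 (hK.memLp_col s)] with r hr
  rw [col, hr]
  ring

theorem integrable_inner_col_mul {K : Kernel2 T} (hK : GoodKernel K) (f g : L2 T) :
    Integrable (fun s => inner ℝ f (col K s) * g s) (leb T) := by
  obtain ⟨C, hC⟩ := hK.exists_col_bound
  refine ((Lp.memLp g).integrable one_le_two).bdd_mul (c := ‖f‖ * C) ?_ (ae_of_all _ fun s => ?_)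
  · exact (stronglyMeasurable_const.inner hK.stronglyMeasurable_col).aestronglyMeasurable
  · exact (norm_inner_le_norm _ _).trans (mul_le_mul_of_nonneg_left (hC s) (norm_nonneg _))

/-- The factor `1_{s<t}` becomes removal of `P_t` in the first term and is automatic in the second,
`K` being Volterra. -/
theorem kernelApply_feedbackKernel {K : Kernel2 T} (hK : GoodKernel K) {lam : ℝ} (hlam : 0 < lam)
    {f : Time T → ℝ} (hf : MemLp f 2 (leb T)) {t : Time T} (ht : MemLp (K t) 2 (leb T)) :
    2 * lam * kernelApply (feedbackKernel lam K) f t =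
      inner ℝ (gainVec lam K t) (intOp K (toL2 f - projFrom t (toL2 f))) - kernelApply K f t := by
  have hi : Integrable (fun s => K t s * f s) (leb T) := ht.integrable_mul hf
  rw [inner_intOp_eq_integral_col hK, kernelApply, kernelApply, ← integral_const_mul,
    ← integral_sub (integrable_inner_col_mul hK _ _) hi]
  refine integral_congr_ae ?_
  filter_upwards [coeFn_sub_projFrom t (toL2 f), coeFn_toL2 hf] with s h1 h2
  rw [h1, h2, feedbackKernel]
  by_cases h : s < t
  · rw [if_pos h, if_pos h]
    field_simp
  · rw [if_neg h, if_neg h, hK.volterra t s (not_lt.1 h)]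
    ring

theorem integral_mul_sub_condExp {m : MeasurableSpace Ω} (hm : m ≤ mΩ) {z X : Ω → ℝ}
    (hz : StronglyMeasurable[m] z) (hz2 : MemLp z 2 P) (hX : MemLp X 2 P) :
    ∫ ω, z ω * (X ω - (P[X | m]) ω) ∂P = 0 := by
  have hzX : Integrable (z * X) P := hz2.integrable_mul hX
  have hzC : Integrable (z * P[X | m]) P := hz2.integrable_mul (hX.condExp one_le_two)
  have h1 := condExp_mul_of_stronglyMeasurable_left hz hzX (hX.integrable one_le_two)
  have h2 : ∫ ω, (z * X) ω ∂P = ∫ ω, (z * P[X | m]) ω ∂P := by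
    rw [← integral_condExp hm (f := z * X)]
    exact integral_congr_ae h1
  have h3 : ∀ ω, z ω * (X ω - (P[X | m]) ω) = (z * X) ω - (z * P[X | m]) ω := fun ω => by
    simp only [Pi.mul_apply]
    ring
  simp_rw [h3]
  rw [integral_sub hzX hzC, h2, sub_self]

/-- The pointwise form of the residual. -/
def residualProcess (lam : ℝ) (K : Kernel2 T) (u d : Time T → Ω → ℝ) : Time T → Ω → ℝ :=
  fun t ω => 2 * lam * u t ω + kernelApply K (fun s => u s ω) t + inner ℝ (col K t) (path u ω)
    - d t ω

theorem residualProcess_coe (hT : 0 ≤ T) {K : Kernel2 T} (hK : GoodKernel K) (lam : ℝ)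
    {u d : Time T → Ω → ℝ} (hu : AdmissibleProcess P ℱ u) (hd : AdmissibleProcess P ℱ d) :
    ∀ᵐ ω ∂P, residual lam K (path u ω) (path d ω) =ᵐ[leb T]
      fun t => residualProcess lam K u d t ω := by
  filter_upwards [hu.path_coe hT, hd.path_coe hT, hu.kernelApply_coe hT hK.sqIntegrable]
    with ω h1 h2 h3
  rw [residual]
  filter_upwards [h1, h2, h3, intOp_apply hK.sqIntegrable.adj (path u ω),
    Lp.coeFn_sub ((2 * lam) • path u ω + intOp K (path u ω) + intOp (adjKernel K) (path u ω))
      (path d ω),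
    Lp.coeFn_add ((2 * lam) • path u ω + intOp K (path u ω)) (intOp (adjKernel K) (path u ω)),
    Lp.coeFn_add ((2 * lam) • path u ω) (intOp K (path u ω)),
    Lp.coeFn_smul (2 * lam) (path u ω)] with t e1 e2 e3 e4 e5 e6 e7 e8
  rw [e5, Pi.sub_apply, e6, Pi.add_apply, e7, Pi.add_apply, e8, Pi.smul_apply, e1, e2, e3, e4,
    residualProcess, smul_eq_mul, inner_L2]
  congr 2
  refine integral_congr_ae ?_
  filter_upwards [coeFn_toL2 (hK.memLp_col t)] with s hs
  rw [col, hs, adjKernel]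

theorem measurable_residualProcess (hT : 0 ≤ T) {K : Kernel2 T} (hK : GoodKernel K) (lam : ℝ)
    {u d : Time T → Ω → ℝ} (hu : AdmissibleProcess P ℱ u) (hd : AdmissibleProcess P ℱ d) :
    Measurable (Function.uncurry (residualProcess lam K u d)) := by
  have h1 := hu.measurable hT
  have h2 := (hu.kernelApply hT hK.measurable hK.volterra hK.sqIntegrable).measurable hT
  have h3 : StronglyMeasurable (path u) := stronglyMeasurable_toL2 h1
  have h4 : Measurable fun p : Time T × Ω => inner ℝ (col K p.1) (path u p.2) :=
    ((hK.stronglyMeasurable_col.comp_measurable measurable_fst).inner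
      (h3.comp_measurable measurable_snd)).measurable
  exact (((h1.const_mul _).add h2).add h4).sub (hd.measurable hT)

/-- The defect `z = u - a - Bu` is itself admissible. Pointwise, the residual is `w_t = 2λ z_t +
(X_t - 𝔼_t X_t)` with `X_t = ⟨K(·,t), u⟩`, and the bracket is orthogonal to the `ℱ_t`-measurable
`z_t`. Testing with `z` therefore gives `2λ 𝔼∫z² = 0`. -/
theorem feedback_form (hT : 0 ≤ T) {K : Kernel2 T} (hK : GoodKernel K) {lam : ℝ} (hlam : 0 < lam)
    {u d a : Time T → Ω → ℝ} (hu : AdmissibleProcess P ℱ u) (hd : AdmissibleProcess P ℱ d)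
    (ha : AdmissibleProcess P ℱ a)
    (haeq : ∀ t, a t =ᵐ[P] fun ω => 1 / (2 * lam) *
      (d t ω - inner ℝ (gainVec lam K t) ((P[path d | ℱ t]) ω)))
    (h : ∀ v, AdmissibleProcess P ℱ v →
      ∫ ω, inner ℝ (path v ω) (residual lam K (path u ω) (path d ω)) ∂P = 0) :
    ∀ᵐ ω ∂P, path u ω - intOp (feedbackKernel lam K) (path u ω) = path a ω := by
  have hB := hu.kernelApply hT (hK.measurable_feedbackKernel hlam)
    (isVolterra_feedbackKernel lam K) (hK.sqIntegrable_feedbackKernel hlam)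
  have hua := hu.sub hT ha
  have hz := hua.sub hT hB
  set z : Time T → Ω → ℝ := fun t ω =>
    u t ω - a t ω - kernelApply (feedbackKernel lam K) (fun s => u s ω) t with hzdef
  set w := residualProcess lam K u d with hw
  have hwm : Measurable (Function.uncurry w) := measurable_residualProcess hT hK lam hu hd
  have hwc := residualProcess_coe hT hK lam hu hd
  have hdL := hd.memLp_path hT
  have hyL := hu.memLp_path hT
  have hres : MemLp (fun ω => residual lam K (path u ω) (path d ω)) 2 P :=
    (((hyL.const_smul (2 * lam)).add ((intOp K).comp_memLp' hyL)).add
      ((intOp (adjKernel K)).comp_memLp' hyL)).sub hdL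
  have hw2 := lintegral_sq_lt_top hwm hres hwc
  have hzm := hz.measurable hT
  have e1 : ∫ t, ∫ ω, z t ω * w t ω ∂P ∂(leb T) = 0 := by
    rw [← integral_inner_path hzm hz.sq_int hwm hw2]
    refine Eq.trans (integral_congr_ae ?_) (h z hz)
    filter_upwards [hwc] with ω hω
    rw [path, path, ← toL2_congr hω, toL2_coe]
  have e2 : ∀ᵐ t ∂(leb T), ∫ ω, z t ω * w t ω ∂P = 2 * lam * ∫ ω, z t ω * z t ω ∂P := by
    filter_upwards [ae_memLp_section hzm hz.sq_int, slices_memLp hK.sqIntegrable] with t hzt hKt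
    have hzs : StronglyMeasurable[ℱ t] (z t) := hz.prog.stronglyAdapted t
    have hX : MemLp (fun ω => inner ℝ (col K t) (path u ω)) 2 P := hyL.const_inner _
    have e3 := integral_mul_sub_condExp (ℱ.le t) hzs hzt hX
    have hzz : Integrable (fun ω => z t ω * z t ω) P := hzt.integrable_mul hzt
    have hzX : Integrable (fun ω => z t ω * (inner ℝ (col K t) (path u ω) -
        (P[fun ω => inner ℝ (col K t) (path u ω) | ℱ t]) ω)) P :=
      hzt.integrable_mul (hX.sub (hX.condExp one_le_two))
    -- Adding the vanishing integral `e3` turns the claim into the pointwise identity for `w`.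
    rw [← integral_const_mul, ← add_zero (∫ ω, 2 * lam * (z t ω * z t ω) ∂P), ← e3,
      ← integral_add (hzz.const_mul _) hzX]
    refine integral_congr_ae ?_
    filter_upwards [hu.ae_memLp hT, haeq t, condExp_inner_col_eq hT hK hlam hu hdL h t]
      with ω h1 h2 h3
    have h4 := kernelApply_feedbackKernel hK hlam h1 hKt
    have h5 : 2 * lam * z t ω = 2 * lam * u t ω -
        (d t ω - inner ℝ (gainVec lam K t) ((P[path d | ℱ t]) ω)) -
        2 * lam * kernelApply (feedbackKernel lam K) (fun s => u s ω) t := by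
      rw [hzdef]
      simp only [h2]
      field_simp
    rw [h3, mul_left_comm, ← mul_add, h5, h4, hw, residualProcess]
    simp only [path]
    ring
  have e4 : ∫ ω, inner ℝ (path z ω) (path z ω) ∂P = 0 := by
    rw [integral_inner_path hzm hz.sq_int hzm hz.sq_int]
    rw [integral_congr_ae e2, integral_const_mul] at e1
    exact (mul_eq_zero.1 e1).resolve_left (by positivity)
  have e5 := (integral_eq_zero_iff_of_nonneg (fun ω => real_inner_self_nonneg)
    (integrable_inner (hz.memLp_path hT) (hz.memLp_path hT))).1 e4
  filter_upwards [e5, hua.path_sub hT hB, hu.path_sub hT ha,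
    hu.kernelApply_coe hT (hK.sqIntegrable_feedbackKernel hlam)] with ω h1 h2 h3 h4
  have h5 : path z ω = 0 := inner_self_eq_zero.1 h1
  have h6 : path (fun t ω => kernelApply (feedbackKernel lam K) (fun s => u s ω) t) ω =
      intOp (feedbackKernel lam K) (path u ω) := by
    rw [path, ← toL2_congr h4, toL2_coe]
  rw [h5, Pi.sub_apply, h3, Pi.sub_apply, h6] at h2
  rw [← sub_eq_zero, h2]
  abel

end Adapted

end StochGame

end

/-! ### The main theorem. -/

open MeasureTheory StochGame in
theorem theorem1 {Ω : Type*} [mΩ : MeasurableSpace Ω] (P : Measure Ω) [IsProbabilityMeasure P]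
    (T : ℝ) (hT : 0 < T) (ℱ : Filtration (Time T) mΩ) (hℱ : UsualConditions P ℱ)
    (N : ℕ) (hN : 2 ≤ N)
    (lam : ℝ) (hlam : 0 < lam) (A1 A2hat A3 : Kernel2 T)
    (hA1 : AdmissibleKernel A1) (hA2 : AdmissibleKernel A2hat) (hA3 : AdmissibleKernel A3)
    (b0 : Time T → Ω → ℝ) (b : Fin N → Time T → Ω → ℝ) (c : Fin N → Ω → ℝ)
    (hb0 : AdmissibleProcess P ℱ b0) (hb : ∀ i, AdmissibleProcess P ℱ (b i))
    (hc : ∀ i, Integrable (c i) P)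
    (u : Fin N → Time T → Ω → ℝ)
    (hu : IsNashEquilibrium P ℱ lam A1 A2hat A3 b0 b c u) :
    (∀ t, IsUnit (opDbar N lam A1 A2hat A3 t)) ∧
    SqIntegrableKernel (kerBbar N lam A1 A2hat A3) ∧
    IsUnit (idSubBbar N lam A1 A2hat A3) ∧
    (∃ a : Time T → Ω → ℝ, AdmissibleProcess P ℱ a ∧
      ∀ t, a t =ᵐ[P] abarAt P ℱ lam A1 A2hat A3 b0 b t) ∧
    (∀ a : Time T → Ω → ℝ, IsStronglyProgressive ℱ a →
      (∀ᵐ t ∂(leb T), a t =ᵐ[P] abarAt P ℱ lam A1 A2hat A3 b0 b t) →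
      ∀ᵐ ω ∂P, path (avg u) ω = Ring.inverse (idSubBbar N lam A1 A2hat A3) (path a ω)) := by
  have hN' : 1 ≤ N := by omega
  have h1 := hA1.good
  have h2 := hA2.good
  have h3 := hA3.good
  have hK := good_kerKbar hN' h1 h2 h3
  have hBeq := kerBbar_eq hN' h1 h2 h3 hlam
  have hB := hK.sqIntegrable_feedbackKernel hlam
  have hunit : IsUnit (idSubBbar N lam A1 A2hat A3) := by
    rw [idSubBbar, hBeq]
    exact isUnit_id_sub_intOp hB (isVolterra_feedbackKernel _ _)
  obtain ⟨a₀, ha₀, ha₀eq⟩ := exists_abar hT.le hN' h1 h2 h3 hlam hb0 hb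
  refine ⟨fun t => ?_, ?_, hunit, ⟨a₀, ha₀, ha₀eq⟩, fun a ha haeq => ?_⟩
  · rw [opDbar_eq h1 h2 h3]
    exact hK.isUnit_truncSymOp hlam t
  · rw [hBeq]
    exact hB
  · have hform := feedback_form hT.le hK hlam (AdmissibleProcess.avg hT.le hu.admissible)
      (admissible_drift hT.le hb0 hb) ha₀
      (fun t => (ha₀eq t).trans (ae_of_all _ fun ω => abarAt_eq hN' h1 h2 h3 hlam t ω))
      (fun v hv => hu.integral_inner_residual hT.le hN' h1 h2 h3 hb0 hb hc hv)
    have hmeas : MeasurableSet {p : Time T × Ω | a p.1 p.2 = a₀ p.1 p.2} :=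
      measurableSet_eq_fun (measurable_uncurry_of_prog hT.le ha) (ha₀.measurable hT.le)
    have hversion : ∀ᵐ t ∂(leb T), ∀ᵐ ω ∂P, a t ω = a₀ t ω := by
      filter_upwards [haeq] with t ht
      exact ht.trans (ha₀eq t).symm
    -- Equality for almost every `t`, almost surely, becomes almost sure equality of paths for
    -- almost every `t`, so `a` and `a₀` give the same element of `L²`.
    rw [Measure.ae_ae_comm hmeas] at hversion
    filter_upwards [hform, hversion] with ω e1 e2
    have e3 : idSubBbar N lam A1 A2hat A3 (path (avg u) ω) = path a ω := by
      rw [path, path, toL2_congr e2, idSubBbar, hBeq]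
      exact e1
    rw [← e3]
    have := Ring.inverse_mul_cancel _ hunit
    exact (congrArg (fun A : L2 T →L[ℝ] L2 T => A (path (avg u) ω)) this).symm
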